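/- Let $\Delta\subset\mathbb{R}^n$ be a convex polytope (the convex hull of a finite set; for instance a non-singular lattice polytope) and let $\Gamma$ be a triangulation of $\Delta$ (a finite geometric simplicial complex with support $\Delta$; for instance a primitive triangulation). Simplices and faces below are nonempty, and $\Delta$ counts as a face of itself. Let \[ \Xi=\{(F,\sigma) : F \text{ a face of } \Delta,\ \sigma\in\Gamma,\ \sigma\subset F\},\qquad (G,\tau)\le(F,\sigma)\iff \sigma\subseteq\tau\subseteq G\subseteq F . \] For a flag $\sigma_\bullet=(\sigma_0\subsetneq\dots\subsetneq\sigma_l)$ of simplices of $\Gamma$, let $S(\sigma_\bullet)$ be the convex hull of the barycenters of $\sigma_0,\dots,\sigma_l$ (a simplex of the barycentric subdivision of $\Gamma$), and for $(F,\sigma)\in\Xi$ let \[ C(F,\sigma)=\bigcup\{\,S(\sigma_\bullet) : \sigma\subseteq\sigma_0,\ \sigma_l\subseteq F\,\}\subset\Delta . \] Then $\Xi$ is the face poset of a regular CW structure on $\Delta$ whose closed cells are the sets $C(F,\sigma)$. That is, there are a CW structure on $\Delta$, all of whose characteristic maps are embeddings of closed balls, and an isomorphism of posets from $\Xi$ to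 the set of its cells ordered by inclusion of closed cells, such that the closed cell corresponding to $(F,\sigma)$ is $C(F,\sigma)$, it has dimension $\dim F-\dim\sigma$, and its boundary is $\bigcup_{(G,\tau)<(F,\sigma)}C(G,\tau)$. -/

import Mathlib

namespace CellPairs

section Polytopes

variable {E : Type*} [NormedAddCommGroup E] [NormedSpace ℝ E]

/-- A convex polytope: the convex hull of a finite set of points. -/
def IsPolytope (Δ : Set E) : Prop := ∃ V : Finset E, Δ = convexHull ℝ (V : Set E)

/-- A triangulation of `Δ`: a finite geometric simplicial complex with support `Δ`. -/
structure IsTriangulation (Γ : Geometry.SimplicialComplex ℝ E) (Δ : Set E) : Prop where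
  finite : Γ.faces.Finite
  space_eq : Γ.space = Δ

/-- The poset of nonempty faces of `Δ` (`Δ` itself included), ordered by inclusion.
A face is the set of maximizers on `Δ` of a linear form. -/
abbrev Fac (Δ : Set E) : Type _ := {F : Set E // F.Nonempty ∧ IsExposed ℝ Δ F}

/-- The poset `Ξ ⊆ Fac Δ × Γᵒᵖ` of cell pairs `(F, σ)`, with `σ` a (nonempty) simplex of `Γ`
contained in the face `F` of `Δ`. A simplex is recorded by its set of vertices, and
`(G, τ) ≤ (F, σ)` means `G ⊆ F` and `σ ⊆ τ`. -/
abbrev Xi (Δ : Set E) (Γ : Geometry.SimplicialComplex ℝ E) : Type _ :=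
  {p : Fac Δ × (Γ.faces)ᵒᵈ // convexHull ℝ ((OrderDual.ofDual p.2).1 : Set E) ⊆ p.1.1}

variable {Δ : Set E} {Γ : Geometry.SimplicialComplex ℝ E}

/-- The face `F` of a cell pair `(F, σ)`. -/
def Xi.face (x : Xi Δ Γ) : Set E := x.1.1.1

/-- The simplex `σ` of a cell pair `(F, σ)`, as an element of the poset `Γ`. -/
def Xi.simplex (x : Xi Δ Γ) : Γ.faces := OrderDual.ofDual x.1.2

/-- The simplex `S(σ₀ ⊊ ⋯ ⊊ σ_l)` of the barycentric subdivision of `Γ`: the convex hull of the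
barycenters of the simplices of the flag. -/
noncomputable def flagSimplex (s : LTSeries Γ.faces) : Set E :=
  convexHull ℝ (Set.range fun i => (s i).1.centroid ℝ id)

/-- The flags of simplices of `Γ` whose first element contains `σ` and whose last element is
contained in `F`. -/
def Xi.flags (x : Xi Δ Γ) : Set (LTSeries Γ.faces) :=
  {s | x.simplex ≤ s.head ∧ convexHull ℝ (s.last.1 : Set E) ⊆ x.face}

/-- The set `C(F, σ)`. -/
def Xi.C (x : Xi Δ Γ) : Set E := ⋃ s ∈ x.flags, flagSimplex s

end Polytopes

section CW

open Topology Set Metric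

variable {X : Type*} [TopologicalSpace X]

/-- A CW structure (on a subspace of a Hausdorff space) is regular if all its characteristic maps
are embeddings of closed balls. -/
def IsRegularCW (C : Set X) [CWComplex C] : Prop :=
  ∀ (n : ℕ) (i : RelCWComplex.cell C n), InjOn (RelCWComplex.map n i) (closedBall 0 1)

/-- The cells of a CW structure, of all dimensions. -/
def CWFace (C : Set X) [CWComplex C] : Type _ := Σ n, RelCWComplex.cell C n

/-- The dimension of a cell. -/
def CWFace.dim {C : Set X} [CWComplex C] (c : CWFace C) : ℕ := c.1

/-- The closed cell as a subset of the ambient space. -/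
def CWFace.closed {C : Set X} [CWComplex C] (c : CWFace C) : Set X :=
  RelCWComplex.closedCell (C := C) c.1 c.2

/-- The boundary of a cell: the image of the boundary sphere under the characteristic map. -/
def CWFace.boundary {C : Set X} [CWComplex C] (c : CWFace C) : Set X :=
  RelCWComplex.cellFrontier (C := C) c.1 c.2

theorem CWFace.dim_lt_of_closed_subset {C : Set X} [CWComplex C] {c d : CWFace C}
    (h : c.closed ⊆ d.closed) (hne : c ≠ d) : c.dim < d.dim := by
  obtain ⟨n, i⟩ := c
  obtain ⟨m, j⟩ := d
  obtain ⟨x, hx⟩ := RelCWComplex.openCell_nonempty (C := C) n i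
  have hx' := h (RelCWComplex.openCell_subset_closedCell n i hx)
  change x ∈ RelCWComplex.closedCell m j at hx'
  rw [← RelCWComplex.cellFrontier_union_openCell_eq_closedCell] at hx'
  rcases hx' with hx' | hx'
  · obtain ⟨I, hI⟩ := CWComplex.cellFrontier_subset_finite_openCell (C := C) m j
    have := hI hx'
    simp only [mem_iUnion] at this
    obtain ⟨k, hk, l, -, hl⟩ := this
    have e := RelCWComplex.eq_of_not_disjoint_openCell
      (Set.not_disjoint_iff.2 ⟨x, hx, hl⟩)
    have e1 : n = k := congrArg Sigma.fst e
    change n < m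
    omega
  · exact absurd (RelCWComplex.eq_of_not_disjoint_openCell
      (Set.not_disjoint_iff.2 ⟨x, hx, hx'⟩)) hne

/-- The face poset of a CW structure: its cells, ordered by inclusion of closed cells. -/
instance {C : Set X} [CWComplex C] : PartialOrder (CWFace C) where
  le c d := c.closed ⊆ d.closed
  le_refl _ := subset_rfl
  le_trans _ _ _ := Subset.trans
  le_antisymm c d h₁ h₂ := by
    by_contra hne
    have := CWFace.dim_lt_of_closed_subset h₁ hne
    have := CWFace.dim_lt_of_closed_subset h₂ (Ne.symm hne)
    omega

end CW

end CellPairs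

/-! Every point of `Δ` has unique barycentric coordinates `c` with respect to `Γ` (`point_injOn`,
`exists_coord`). In these coordinates `C(F, σ)` consists of the `c` supported on vertices in `F` and
attaining their maximum at every vertex of `σ` (`Xi.C_eq`). The open cell asks in addition that the
point lie in the relative interior of `F` and that `σ` be the whole set of maximizing vertices. So
each point lies in an open cell, given by the smallest face containing it and its set of maximizing
vertices (`exists_mem_openCoords`), and the open cell of `x` meets the closed cell of `y` only if `x
≤ y` (`Xi.le_of_mem`). Disjointness, the boundary formula and the order isomorphism follow from
this.

It remains to see that each closed cell is a ball with the open cell as its interior. Project the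
directions of `F` modulo those of `σ` onto `ℝ^d`, with `d = dim F - dim σ`. The simplices containing
`σ` project to a simplicial fan (`fan_injective`), so the projection determines the coordinates off
`σ`. On `C(F, σ)` the coordinates at `σ` all equal one number, which the coordinates `t` off `σ`
determine, and the condition that it dominate `t` reads `height t ≤ 1`, where `height` is positively
homogeneous. Rescaling each ray so that norm equals height therefore turns `C(F, σ)` into the part
of the projected cone of `F` in the unit ball (`Xi.image_rescale`), and the open cell into its
interior (`Xi.mem_openCoords_iff`). This is a compact convex body, hence a ball
(`Xi.exists_charMap`). -/

namespace CellPairs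

/-! ### Barycentric coordinates on a simplicial complex. -/

section Coordinates

open Set

variable {E : Type*} [NormedAddCommGroup E] [NormedSpace ℝ E]

/-- The point with coordinates `c` with respect to the finite set `N` of vertices. -/
def point (N : Finset E) (c : E → ℝ) : E := ∑ u ∈ N, c u • u

/-- The barycentric coordinates of the points of a simplicial complex. -/
def coordSet (Γ : Geometry.SimplicialComplex ℝ E) : Set (E → ℝ) :=
  {c | (∀ u, 0 ≤ c u) ∧ ∃ τ ∈ Γ.faces, (∀ u ∉ τ, c u = 0) ∧ ∑ u ∈ τ, c u = 1}

variable {Δ : Set E} {Γ : Geometry.SimplicialComplex ℝ E} {N τ : Finset E} {c d : E → ℝ}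

theorem point_eq_of_subset (hτ : τ ⊆ N) (hc : ∀ u ∉ τ, c u = 0) :
    point N c = ∑ u ∈ τ, c u • u :=
  (Finset.sum_subset hτ fun u _ hu => by rw [hc u hu, zero_smul]).symm

theorem sum_eq_of_subset {α : Type*} {N τ : Finset α} {c : α → ℝ} (hτ : τ ⊆ N) (hc : ∀ u ∉ τ, c u = 0) :
    ∑ u ∈ N, c u = ∑ u ∈ τ, c u :=
  (Finset.sum_subset hτ fun u _ hu => hc u hu).symm

theorem eq_zero_of_sum_smul_eq_zero (h : AffineIndependent ℝ ((↑) : τ → E))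
    (h1 : ∑ u ∈ τ, c u = 0) (h2 : ∑ u ∈ τ, c u • u = 0) : ∀ u ∈ τ, c u = 0 := by
  intro u hu
  have := affineIndependent_iff.1 h Finset.univ (fun u => c u)
    ((Finset.sum_coe_sort τ c).trans h1)
    ((Finset.sum_coe_sort τ fun u => c u • u).trans h2) ⟨u, hu⟩ (Finset.mem_univ _)
  exact this

theorem eq_of_sum_smul_eq (h : AffineIndependent ℝ ((↑) : τ → E))
    (hc : ∀ u ∉ τ, c u = 0) (hd : ∀ u ∉ τ, d u = 0) (h1 : ∑ u ∈ τ, c u = ∑ u ∈ τ, d u)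
    (h2 : ∑ u ∈ τ, c u • u = ∑ u ∈ τ, d u • u) : c = d := by
  funext u
  by_cases hu : u ∈ τ
  · have := eq_zero_of_sum_smul_eq_zero (c := c - d) h (by simp [h1])
      (by simp [sub_smul, h2]) u hu
    simpa [sub_eq_zero] using this
  · rw [hc u hu, hd u hu]

theorem sum_coordSet (hN : ∀ τ ∈ Γ.faces, τ ⊆ N) (hc : c ∈ coordSet Γ) : ∑ u ∈ N, c u = 1 := by
  obtain ⟨-, τ, hτ, h, h1⟩ := hc
  rw [sum_eq_of_subset (hN τ hτ) h, h1]

theorem mem_convexHull_of_coord (h0 : ∀ u, 0 ≤ c u) (h1 : ∑ u ∈ τ, c u = 1) :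
    ∑ u ∈ τ, c u • u ∈ convexHull ℝ (τ : Set E) :=
  Finset.mem_convexHull'.2 ⟨c, fun u _ => h0 u, h1, rfl⟩

/-- Two representations of one point put it in the intersection of their simplices, which is spanned
by the common vertices. Affine independence in either simplex then forces both to equal a
representation `e` on those vertices. -/
theorem point_injOn (hN : ∀ τ ∈ Γ.faces, τ ⊆ N) : InjOn (point N) (coordSet Γ) := by
  classical
  rintro c ⟨c0, τ, hτ, hcτ, c1⟩ d ⟨d0, τ', hτ', hdτ, d1⟩ h
  rw [point_eq_of_subset (hN τ hτ) hcτ, point_eq_of_subset (hN τ' hτ') hdτ] at h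
  have hp := Γ.inter_subset_convexHull hτ hτ'
    ⟨mem_convexHull_of_coord c0 c1, h ▸ mem_convexHull_of_coord d0 d1⟩
  rw [← Finset.coe_inter, Finset.mem_convexHull'] at hp
  obtain ⟨w, -, w1, hw⟩ := hp
  let e : E → ℝ := fun u => if u ∈ τ ∩ τ' then w u else 0
  have he : ∀ u ∉ τ ∩ τ', e u = 0 := fun u hu => if_neg hu
  have e1 : ∑ u ∈ τ ∩ τ', e u = 1 := by
    rw [← w1]; exact Finset.sum_congr rfl fun u hu => if_pos hu
  have e2 : ∑ u ∈ τ ∩ τ', e u • u = ∑ u ∈ τ, c u • u := by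
    rw [← hw]; exact Finset.sum_congr rfl fun u hu => by rw [show e u = w u from if_pos hu]
  have hl := Finset.inter_subset_left (s₁ := τ) (s₂ := τ')
  have hr := Finset.inter_subset_right (s₁ := τ) (s₂ := τ')
  have h1 : c = e := eq_of_sum_smul_eq (Γ.indep hτ) hcτ (fun u hu => he u fun h => hu (hl h))
    (by rw [c1, sum_eq_of_subset hl he, e1])
    (by rw [← e2]; exact (point_eq_of_subset hl he).symm)
  have h2 : d = e := eq_of_sum_smul_eq (Γ.indep hτ') hdτ (fun u hu => he u fun h => hu (hr h))
    (by rw [d1, sum_eq_of_subset hr he, e1])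
    (by rw [← h, ← e2]; exact (point_eq_of_subset hr he).symm)
  rw [h1, h2]

theorem exists_coord_of_mem (hN : ∀ τ ∈ Γ.faces, τ ⊆ N) (hτ : τ ∈ Γ.faces) {p : E}
    (hp : p ∈ convexHull ℝ (τ : Set E)) :
    ∃ c ∈ coordSet Γ, (∀ u ∉ τ, c u = 0) ∧ point N c = p := by
  classical
  obtain ⟨w, w0, w1, hw⟩ := Finset.mem_convexHull'.1 hp
  have key : ∀ u ∈ τ, (if u ∈ τ then w u else 0) = w u := fun u hu => if_pos hu
  have h0 : ∀ u ∉ τ, (if u ∈ τ then w u else 0) = 0 := fun u hu => if_neg hu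
  refine ⟨fun u => if u ∈ τ then w u else 0, ⟨fun u => ?_, τ, hτ, h0, ?_⟩, h0, ?_⟩
  · dsimp only
    split_ifs with h
    exacts [w0 u h, le_rfl]
  · rw [← w1]; exact Finset.sum_congr rfl key
  · rw [point_eq_of_subset (hN τ hτ) h0, ← hw]
    exact Finset.sum_congr rfl fun u hu => by rw [key u hu]

theorem exists_coord (hN : ∀ τ ∈ Γ.faces, τ ⊆ N) {p : E} (hp : p ∈ Γ.space) :
    ∃ c ∈ coordSet Γ, point N c = p := by
  obtain ⟨τ, hτ, hp⟩ := Geometry.SimplicialComplex.mem_space_iff.1 hp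
  obtain ⟨c, hc, -, h⟩ := exists_coord_of_mem hN hτ hp
  exact ⟨c, hc, h⟩

/-- The support of a system of barycentric coordinates is a simplex. -/
theorem exists_support (hc : c ∈ coordSet Γ) :
    ∃ τ ∈ Γ.faces, (∀ u, u ∈ τ ↔ c u ≠ 0) ∧ ∑ u ∈ τ, c u = 1 := by
  classical
  obtain ⟨h0, τ, hτ, h, h1⟩ := hc
  have h1' : ∑ u ∈ τ with c u ≠ 0, c u = 1 := by
    rw [Finset.sum_filter_ne_zero, h1]
  refine ⟨τ.filter fun u => c u ≠ 0, Γ.down_closed hτ (Finset.filter_subset _ _) ?_, fun u => ?_, h1'⟩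
  · rw [Finset.nonempty_iff_ne_empty]
    intro h
    rw [h] at h1'
    simp at h1'
  · rw [Finset.mem_filter]
    exact ⟨fun h => h.2, fun hu => ⟨by_contra fun h' => hu (h u h'), hu⟩⟩

theorem coord_eq_zero (hN : ∀ τ ∈ Γ.faces, τ ⊆ N) (hc : c ∈ coordSet Γ) {u : E} (hu : u ∉ N) :
    c u = 0 := by
  obtain ⟨-, τ, hτ, h, -⟩ := hc
  exact h u fun h' => hu (hN τ hτ h')

theorem exists_coord_pos (hc : c ∈ coordSet Γ) : ∃ u, 0 < c u := by
  obtain ⟨τ, hτ, h, -⟩ := exists_support hc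
  obtain ⟨u, hu⟩ := Γ.nonempty_of_mem_faces hτ
  exact ⟨u, (hc.1 u).lt_of_ne ((h u).1 hu).symm⟩

end Coordinates

/-! ### The cells `C(F, σ)` in barycentric coordinates. -/

section Flags

open Set

variable {E : Type*} [NormedAddCommGroup E] [NormedSpace ℝ E]
  {Δ : Set E} {Γ : Geometry.SimplicialComplex ℝ E} {N : Finset E}

theorem centroid_eq_sum {σ : Finset E} (h : σ.Nonempty) :
    σ.centroid ℝ id = ∑ u ∈ σ, (σ.card : ℝ)⁻¹ • u := by
  rw [Finset.centroid_def, Finset.affineCombination_eq_linear_combination _ _ _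
    (σ.sum_centroidWeights_eq_one_of_nonempty ℝ h)]
  rfl

/-- The barycentric coordinates of the points of `C(F, σ)`. -/
def Xi.coords (x : Xi Δ Γ) : Set (E → ℝ) :=
  {c ∈ coordSet Γ | (∀ u, c u ≠ 0 → u ∈ x.face) ∧ ∀ v ∈ x.simplex.1, ∀ u, c u ≤ c v}

/-- The conditions on `c` survive convex combinations, so only the barycenters of the flag need
checking. The coordinates of each are constant on a simplex containing `σ` and zero elsewhere. -/
theorem flagSimplex_subset {σ : Finset E} {s : LTSeries Γ.faces} (hs : σ ⊆ s.head.1) :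
    flagSimplex s ⊆ {p | ∃ c : E → ℝ, ((∀ u, 0 ≤ c u) ∧ (∀ u ∉ s.last.1, c u = 0) ∧
      ∑ u ∈ s.last.1, c u = 1 ∧ ∀ v ∈ σ, ∀ u, c u ≤ c v) ∧ ∑ u ∈ s.last.1, c u • u = p} := by
  classical
  refine convexHull_min ?_ ?_
  · rintro _ ⟨i, rfl⟩
    have hne : (s i).1.Nonempty := Γ.nonempty_of_mem_faces (s i).2
    have hi : (s i).1 ⊆ s.last.1 := s.monotone (Fin.le_last i)
    have h0 : ∀ u ∉ (s i).1, (if u ∈ (s i).1 then ((s i).1.card : ℝ)⁻¹ else 0) = 0 :=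
      fun u hu => if_neg hu
    refine ⟨fun u => if u ∈ (s i).1 then ((s i).1.card : ℝ)⁻¹ else 0, ⟨?_, ?_, ?_, ?_⟩, ?_⟩
    · intro u; dsimp only; split_ifs <;> positivity
    · exact fun u hu => h0 u fun h => hu (hi h)
    · rw [sum_eq_of_subset hi h0, Finset.sum_congr rfl fun u hu => if_pos hu, Finset.sum_const,
        nsmul_eq_mul, mul_inv_cancel₀]
      exact_mod_cast hne.card_ne_zero
    · intro v hv u
      have : v ∈ (s i).1 := (show s.head.1 ⊆ (s i).1 from s.monotone (Fin.zero_le i)) (hs hv)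
      dsimp only
      rw [if_pos this]
      split_ifs
      · exact le_rfl
      · positivity
    · change _ = (s i).1.centroid ℝ id
      rw [centroid_eq_sum hne]
      refine (point_eq_of_subset hi h0).trans (Finset.sum_congr rfl fun u hu => ?_)
      rw [if_pos hu]
  · rintro _ ⟨c, ⟨c0, c1, c2, c3⟩, rfl⟩ _ ⟨d, ⟨d0, d1, d2, d3⟩, rfl⟩ a b ha hb hab
    refine ⟨fun u => a * c u + b * d u, ⟨fun u => ?_, fun u hu => ?_, ?_, fun v hv u => ?_⟩, ?_⟩
    · have := c0 u; have := d0 u; positivity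
    · simp [c1 u hu, d1 u hu]
    · rw [Finset.sum_add_distrib, ← Finset.mul_sum, ← Finset.mul_sum, c2, d2, mul_one, mul_one, hab]
    · exact add_le_add (mul_le_mul_of_nonneg_left (c3 v hv u) ha)
        (mul_le_mul_of_nonneg_left (d3 v hv u) hb)
    · simp only [add_smul, mul_smul, Finset.sum_add_distrib, Finset.smul_sum]

/-- Layer-cake decomposition: subtracting the minimum `m` of `c` on its support `τ` splits off a
multiple of the barycenter of `τ` and leaves a function with smaller support. The total mass changes
under this, hence the normalization by `∑ c`. -/
theorem exists_flag (n : ℕ) : ∀ (c : E → ℝ) (τ : Finset E) (hτ : τ ∈ Γ.faces), τ.card = n →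
    (∀ u, 0 ≤ c u) → (∀ u, u ∈ τ ↔ c u ≠ 0) →
    ∃ s : LTSeries Γ.faces, s.last = ⟨τ, hτ⟩ ∧ (∀ v ∈ τ, (∀ u, c u ≤ c v) → v ∈ s.head.1) ∧
      (∑ u ∈ τ, c u)⁻¹ • ∑ u ∈ τ, c u • u ∈ flagSimplex s := by
  classical
  induction n using Nat.strong_induction_on with
  | _ n ih =>
  intro c τ hτ hn c0 hcτ
  have hne := Γ.nonempty_of_mem_faces hτ
  obtain ⟨v₀, hv₀, hmin⟩ := Finset.exists_min_image τ c hne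
  set m := c v₀ with hm
  have m0 : 0 < m := (c0 v₀).lt_of_ne ((hcτ v₀).1 hv₀).symm
  have hcard : (0 : ℝ) < τ.card := by exact_mod_cast hne.card_pos
  by_cases hconst : ∀ u ∈ τ, c u = m
  · refine ⟨RelSeries.singleton _ ⟨τ, hτ⟩, rfl, fun v hv _ => hv, ?_⟩
    have : (∑ u ∈ τ, c u)⁻¹ • ∑ u ∈ τ, c u • u = τ.centroid ℝ id := by
      rw [centroid_eq_sum hne, Finset.sum_congr rfl hconst, Finset.sum_const, nsmul_eq_mul,
        Finset.sum_congr rfl fun u hu => by rw [hconst u hu], ← Finset.smul_sum, ← Finset.smul_sum,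
        smul_smul]
      congr 1
      field_simp
    rw [this]
    exact subset_convexHull _ _ ⟨0, rfl⟩
  push Not at hconst
  obtain ⟨u₁, hu₁, hu₁m⟩ := hconst
  let τ' := τ.filter fun u => c u ≠ m
  have hsub : τ' ⊆ τ := Finset.filter_subset _ _
  have hτ' : τ' ∈ Γ.faces := Γ.down_closed hτ hsub ⟨u₁, Finset.mem_filter.2 ⟨hu₁, hu₁m⟩⟩
  have hss : τ' ⊂ τ := (Finset.ssubset_iff_of_subset hsub).2 ⟨v₀, hv₀, by simp [τ', hm]⟩
  let c' : E → ℝ := fun u => if u ∈ τ then c u - m else 0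
  have hc' : ∀ u ∈ τ, c' u = c u - m := fun u hu => if_pos hu
  have hc'0 : ∀ u ∉ τ', c' u = 0 := by
    intro u hu
    by_cases h : u ∈ τ
    · rw [hc' u h, sub_eq_zero]
      by_contra h'
      exact hu (Finset.mem_filter.2 ⟨h, h'⟩)
    · exact if_neg h
  have c'0 : ∀ u, 0 ≤ c' u := by
    intro u
    by_cases h : u ∈ τ
    · rw [hc' u h]; exact sub_nonneg.2 (hmin u h)
    · exact (if_neg h).ge
  have hτc' : ∀ u, u ∈ τ' ↔ c' u ≠ 0 := by
    refine fun u => ⟨fun hu => ?_, fun hu => by_contra fun h => hu (hc'0 u h)⟩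
    rw [hc' u (hsub hu), sub_ne_zero]
    exact (Finset.mem_filter.1 hu).2
  obtain ⟨s, hs, hhead, hmem⟩ := ih _ (hn ▸ Finset.card_lt_card hss) c' τ' hτ' rfl c'0 hτc'
  have hlt : s.last < (⟨τ, hτ⟩ : Γ.faces) := by rw [hs]; exact hss
  refine ⟨s.snoc ⟨τ, hτ⟩ hlt, RelSeries.last_snoc _ _ _, fun v hv hvmax => ?_, ?_⟩
  · rw [RelSeries.head_snoc]
    -- As `c` is not constant on `τ`, a maximizing vertex is not minimizing, so it survives into
    -- `τ'`.
    have hvm : c v ≠ m := fun h => hu₁m (le_antisymm (h ▸ hvmax u₁) (hmin u₁ hu₁))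
    refine hhead v (Finset.mem_filter.2 ⟨hv, hvm⟩) fun u => ?_
    rw [hc' v hv]
    by_cases h : u ∈ τ
    · rw [hc' u h]; exact sub_le_sub_right (hvmax u) _
    · rw [show c' u = 0 from if_neg h]; exact sub_nonneg.2 (hmin v hv)
  · have hmem' : (∑ u ∈ τ', c' u)⁻¹ • ∑ u ∈ τ', c' u • u ∈ flagSimplex (s.snoc ⟨τ, hτ⟩ hlt) := by
      refine convexHull_mono ?_ hmem
      rintro _ ⟨i, rfl⟩
      exact ⟨i.castSucc, congrArg (fun t : Γ.faces => t.1.centroid ℝ id)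
        (RelSeries.snoc_castSucc s ⟨τ, hτ⟩ hlt i)⟩
    have hcent : τ.centroid ℝ id ∈ flagSimplex (s.snoc ⟨τ, hτ⟩ hlt) := by
      refine subset_convexHull _ _ ⟨Fin.last _, ?_⟩
      have : (s.snoc ⟨τ, hτ⟩ hlt) (Fin.last _) = ⟨τ, hτ⟩ := RelSeries.last_snoc _ _ _
      simp only [this]
    rw [centroid_eq_sum hne, ← Finset.smul_sum] at hcent
    have hS : ∑ u ∈ τ, c u = ∑ u ∈ τ', c' u + τ.card * m := by
      rw [← sum_eq_of_subset hsub hc'0, Finset.sum_congr rfl hc', Finset.sum_sub_distrib,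
        Finset.sum_const, nsmul_eq_mul]
      ring
    have hP : ∑ u ∈ τ, c u • u = ∑ u ∈ τ', c' u • u + m • ∑ u ∈ τ, u := by
      have : ∑ u ∈ τ, c' u • u = ∑ u ∈ τ, (c u • u - m • u) :=
        Finset.sum_congr rfl fun u hu => by rw [hc' u hu, sub_smul]
      rw [← point_eq_of_subset hsub hc'0, point, this, Finset.sum_sub_distrib, ← Finset.smul_sum,
        sub_add_cancel]
    set S := ∑ u ∈ τ', c' u with hSdef
    have S0 : 0 < S := by
      refine Finset.sum_pos (fun u hu => (c'0 u).lt_of_ne ((hτc' u).1 hu).symm) ?_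
      exact Γ.nonempty_of_mem_faces hτ'
    have hT : 0 < S + τ.card * m := by positivity
    have hconv : Convex ℝ (flagSimplex (s.snoc ⟨τ, hτ⟩ hlt)) := convex_convexHull ℝ _
    -- The removed layer has mass `τ.card * m` and the rest has mass `S`; these are the weights of
    -- the convex combination.
    have := hconv hmem' hcent (a := S / (S + τ.card * m))
      (b := τ.card * m / (S + τ.card * m)) (by positivity) (by positivity)
      (by field_simp)
    have e₁ : (S + τ.card * m)⁻¹ = S / (S + τ.card * m) * S⁻¹ := by field_simp
    have e₂ : (S + τ.card * m)⁻¹ * m = τ.card * m / (S + τ.card * m) * (τ.card : ℝ)⁻¹ := by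
      field_simp
    rw [smul_smul, smul_smul, ← e₁, ← e₂, mul_smul, ← smul_add] at this
    rwa [hS, hP]

theorem Xi.C_eq (hN : ∀ τ ∈ Γ.faces, τ ⊆ N) (x : Xi Δ Γ) (hF : Convex ℝ x.face) :
    x.C = point N '' x.coords := by
  ext p
  simp only [Xi.C, mem_iUnion, exists_prop]
  constructor
  · rintro ⟨s, ⟨hs, hs'⟩, hp⟩
    obtain ⟨c, ⟨c0, c1, c2, c3⟩, rfl⟩ := flagSimplex_subset hs hp
    refine ⟨c, ⟨⟨c0, _, s.last.2, c1, c2⟩, fun u hu => hs' (subset_convexHull _ _ ?_), c3⟩,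
      point_eq_of_subset (hN _ s.last.2) c1⟩
    exact by_contra fun h => hu (c1 u h)
  · rintro ⟨c, ⟨hc, hcF, hcσ⟩, rfl⟩
    obtain ⟨τ, hτ, hcτ, h1⟩ := exists_support hc
    have hτ0 : ∀ u ∉ τ, c u = 0 := fun u hu => by_contra fun h => hu ((hcτ u).2 h)
    obtain ⟨s, hs, hhead, hmem⟩ := exists_flag _ c τ hτ rfl hc.1 hcτ
    refine ⟨s, ⟨fun v hv => hhead v ?_ (hcσ v hv), ?_⟩, ?_⟩
    · obtain ⟨u, hu⟩ := exists_coord_pos hc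
      exact (hcτ v).2 (hu.trans_le (hcσ v hv u)).ne'
    · rw [hs]
      exact convexHull_min (fun u hu => hcF u ((hcτ u).1 hu)) hF
    · rwa [point_eq_of_subset (hN τ hτ) hτ0, ← one_smul ℝ (∑ u ∈ τ, c u • u), ← inv_one, ← h1]

end Flags

/-! ### Exposed faces of a polytope and relative interiors. -/

section Faces

open Set

variable {E : Type*} [NormedAddCommGroup E] [NormedSpace ℝ E]

/-- An average of numbers at most `M` reaches `M` only if every term of nonzero weight does. -/
theorem eq_of_sum_smul_eq_max {τ : Finset E} {w : E → ℝ} {l : StrongDual ℝ E} {M : ℝ}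
    (h0 : ∀ u ∈ τ, 0 ≤ w u) (h1 : ∑ u ∈ τ, w u = 1) (hM : ∀ u ∈ τ, l u ≤ M)
    (h : M ≤ l (∑ u ∈ τ, w u • u)) : ∀ u ∈ τ, w u ≠ 0 → l u = M := by
  have hn : ∀ u ∈ τ, 0 ≤ w u * (M - l u) := fun u hu =>
    mul_nonneg (h0 u hu) (sub_nonneg.2 (hM u hu))
  have hs : ∑ u ∈ τ, w u * (M - l u) = M - l (∑ u ∈ τ, w u • u) := by
    simp only [mul_sub, Finset.sum_sub_distrib, ← Finset.sum_mul, h1, one_mul, map_sum, map_smul,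
      smul_eq_mul]
  have hz : ∑ u ∈ τ, w u * (M - l u) = 0 :=
    le_antisymm (hs ▸ sub_nonpos.2 h) (Finset.sum_nonneg hn)
  intro u hu hw
  have := (Finset.sum_eq_zero_iff_of_nonneg hn).1 hz u hu
  exact (sub_eq_zero.1 ((mul_eq_zero.1 this).resolve_left hw)).symm

theorem apply_sum_smul_eq {τ : Finset E} {w : E → ℝ} {l : StrongDual ℝ E} {M : ℝ}
    (h1 : ∑ u ∈ τ, w u = 1) (h : ∀ u ∈ τ, w u ≠ 0 → l u = M) :
    l (∑ u ∈ τ, w u • u) = M := by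
  rw [map_sum, Finset.sum_congr rfl fun u hu => show l (w u • u) = w u * M from ?_,
    ← Finset.sum_mul, h1, one_mul]
  by_cases hw : w u = 0
  · simp [hw]
  · rw [map_smul, smul_eq_mul, h u hu hw]

/-- An exposed face of an exposed face of a polytope is an exposed face of the polytope. -/
theorem IsPolytope.isExposed_trans {Δ F G : Set E} (hΔ : IsPolytope Δ) (hF : IsExposed ℝ Δ F)
    (hG : IsExposed ℝ F G) : IsExposed ℝ Δ G := by
  classical
  rintro ⟨x₀, hx₀⟩
  have hx₀F := hG.subset hx₀
  obtain ⟨l₁, hl₁⟩ := hF ⟨x₀, hx₀F⟩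
  obtain ⟨l₂, hl₂⟩ := hG ⟨x₀, hx₀⟩
  obtain ⟨V, hV⟩ := hΔ
  have hx₀Δ := hF.subset hx₀F
  have h₁ : ∀ y ∈ Δ, l₁ y ≤ l₁ x₀ := by rw [hl₁] at hx₀F; exact hx₀F.2
  have h₂ : ∀ y ∈ F, l₂ y ≤ l₂ x₀ := by rw [hl₂] at hx₀; exact hx₀.2
  have memF : ∀ y ∈ Δ, l₁ y = l₁ x₀ → y ∈ F := fun y hy h => by
    rw [hl₁]; exact ⟨hy, fun z hz => h ▸ h₁ z hz⟩
  have hVΔ : ∀ v ∈ V, v ∈ Δ := fun v hv => hV ▸ subset_convexHull ℝ _ hv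
  -- The exposing form is `k • l₁ + l₂`, with `k` so large that every vertex off `F` loses more
  -- through `l₁` than it can gain through `l₂`. Vertices on `F` give a division by zero, whose
  -- value is harmless since the bound is used only off `F`.
  obtain ⟨k, hk⟩ := (V.image fun v => (l₂ v - l₂ x₀) / (l₁ x₀ - l₁ v) + 1).exists_le
  have key : ∀ v ∈ V, l₁ v < l₁ x₀ → (k • l₁ + l₂) v < (k • l₁ + l₂) x₀ := by
    intro v hv hlt
    have hpos := sub_pos.2 hlt
    have := hk _ (Finset.mem_image_of_mem _ hv)
    have h3 : (l₂ v - l₂ x₀) / (l₁ x₀ - l₁ v) < k := by linarith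
    rw [div_lt_iff₀ hpos] at h3
    simp only [add_apply, smul_apply, smul_eq_mul]
    linarith
  have hle : ∀ v ∈ V, (k • l₁ + l₂) v ≤ (k • l₁ + l₂) x₀ := by
    intro v hv
    rcases (h₁ v (hVΔ v hv)).lt_or_eq with h | h
    · exact (key v hv h).le
    · have := h₂ v (memF v (hVΔ v hv) h)
      simp only [add_apply, smul_apply, smul_eq_mul, h]
      linarith
  refine ⟨k • l₁ + l₂, Subset.antisymm (fun x hx => ⟨hF.subset (hG.subset hx), fun y hy => ?_⟩)
    fun x hx => ?_⟩
  · have e₁ : l₁ x = l₁ x₀ := by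
      refine le_antisymm (h₁ x (hF.subset (hG.subset hx))) ?_
      have := hG.subset hx
      rw [hl₁] at this
      exact this.2 x₀ hx₀Δ
    have e₂ : l₂ x = l₂ x₀ := by
      refine le_antisymm (h₂ x (hG.subset hx)) ?_
      rw [hl₂] at hx
      exact hx.2 x₀ hx₀F
    have e : (k • l₁ + l₂) x = (k • l₁ + l₂) x₀ := by simp [e₁, e₂]
    rw [e]
    have : Δ ⊆ {y | (k • l₁ + l₂) y ≤ (k • l₁ + l₂) x₀} := by
      rw [hV]
      exact convexHull_min hle (convex_halfSpace_le (k • l₁ + l₂).toLinearMap.isLinear _)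
    exact this hy
  · obtain ⟨hxΔ, hx⟩ := hx
    have hx' := hxΔ
    rw [hV, Finset.mem_convexHull'] at hx'
    obtain ⟨w, w0, w1, rfl⟩ := hx'
    have hmax := eq_of_sum_smul_eq_max w0 w1 hle (hx x₀ hx₀Δ)
    have e₁ : ∀ v ∈ V, w v ≠ 0 → l₁ v = l₁ x₀ := fun v hv hw =>
      (h₁ v (hVΔ v hv)).lt_or_eq.resolve_left fun h => (key v hv h).ne (hmax v hv hw)
    have e₂ : ∀ v ∈ V, w v ≠ 0 → l₂ v = l₂ x₀ := fun v hv hw => by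
      have := hmax v hv hw
      simpa [e₁ v hv hw] using this
    rw [hl₂]
    refine ⟨memF _ hxΔ (apply_sum_smul_eq w1 e₁), fun y hy => ?_⟩
    rw [apply_sum_smul_eq w1 e₂]
    exact h₂ y hy

/-- The relative interior of a convex set, described by its supporting linear forms. -/
def supportInterior (F : Set E) : Set E :=
  {x ∈ F | ∀ l : StrongDual ℝ E, (∀ y ∈ F, l y ≤ l x) → ∀ y ∈ F, l y = l x}

theorem subset_of_mem_supportInterior {Δ F G : Set E} {x : E} (hx : x ∈ supportInterior F)
    (hFΔ : F ⊆ Δ) (hG : IsExposed ℝ Δ G) (hxG : x ∈ G) : F ⊆ G := by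
  obtain ⟨l, rfl⟩ := hG ⟨x, hxG⟩
  intro y hy
  refine ⟨hFΔ hy, fun z hz => ?_⟩
  rw [hx.2 l (fun y hy => hxG.2 y (hFΔ hy)) y hy]
  exact hxG.2 z hz

/-- The form `l` vanishes on the directions of `G`, but not on all those of `F`. -/
theorem finrank_vectorSpan_lt [FiniteDimensional ℝ E] {F G : Set E} (hGF : G ⊆ F)
    (l : StrongDual ℝ E) {M : ℝ} (hG : ∀ y ∈ G, l y = M) (hne : G.Nonempty)
    (hF : ∃ y ∈ F, l y ≠ M) :
    Module.finrank ℝ (vectorSpan ℝ G) < Module.finrank ℝ (vectorSpan ℝ F) := by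
  refine Submodule.finrank_lt_finrank_of_lt (lt_of_le_of_ne (vectorSpan_mono ℝ hGF) fun h => ?_)
  obtain ⟨y, hy, hyM⟩ := hF
  obtain ⟨x, hx⟩ := hne
  have hle : vectorSpan ℝ G ≤ LinearMap.ker l.toLinearMap := by
    rw [vectorSpan_def, Submodule.span_le]
    rintro _ ⟨a, ha, b, hb, rfl⟩
    simp [hG a ha, hG b hb]
  have hm : y - x ∈ vectorSpan ℝ G := h ▸ vsub_mem_vectorSpan ℝ hy (hGF hx)
  have := hle hm
  simp only [LinearMap.mem_ker, ContinuousLinearMap.coe_coe, map_sub, hG x hx] at this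
  exact hyM (sub_eq_zero.1 this)

theorem IsExposed.finrank_vectorSpan_lt [FiniteDimensional ℝ E] {Δ F G : Set E}
    (hG : IsExposed ℝ Δ G) (hne : G.Nonempty) (hF : F ⊆ Δ) (hlt : G ⊂ F) :
    Module.finrank ℝ (vectorSpan ℝ G) < Module.finrank ℝ (vectorSpan ℝ F) := by
  obtain ⟨l, hl⟩ := hG hne
  obtain ⟨x, hx⟩ := hne
  obtain ⟨y, hy, hyG⟩ := exists_of_ssubset hlt
  have hGx : ∀ z ∈ G, ∀ y ∈ Δ, l y ≤ l z := fun z hz => by rw [hl] at hz; exact hz.2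
  have hΔ := hG.subset
  refine CellPairs.finrank_vectorSpan_lt hlt.1 l (M := l x)
    (fun z hz => le_antisymm (hGx x hx z (hΔ hz)) (hGx z hz x (hΔ hx))) ⟨x, hx⟩ ⟨y, hy, fun h => ?_⟩
  refine hyG ?_
  rw [hl]
  exact ⟨hF hy, fun z hz => h ▸ hGx x hx z hz⟩

/-- Take a face through `x` of least dimension. A form maximal at `x` but not constant there would
expose a smaller face through `x`, again a face of `Δ` by `IsPolytope.isExposed_trans`. -/
theorem IsPolytope.exists_face [FiniteDimensional ℝ E] {Δ : Set E} (hΔ : IsPolytope Δ) {x : E}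
    (hx : x ∈ Δ) : ∃ F : Fac Δ, x ∈ supportInterior F.1 := by
  let S : Set (Set E) := {F | IsExposed ℝ Δ F ∧ x ∈ F}
  have hS : S.Nonempty := ⟨Δ, IsExposed.refl Δ, hx⟩
  let f : Set E → ℕ := fun F => Module.finrank ℝ (vectorSpan ℝ F)
  obtain ⟨hF, hxF⟩ := Function.argminOn_mem f S hS
  set F := Function.argminOn f S hS
  refine ⟨⟨F, ⟨x, hxF⟩, hF⟩, hxF, fun l hl => ?_⟩
  by_contra! hcon
  have hG : {z ∈ F | ∀ y ∈ F, l y ≤ l z} ∈ S := ⟨hΔ.isExposed_trans hF fun _ => ⟨l, rfl⟩, hxF, hl⟩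
  refine (Function.argminOn_le f S hG).not_gt ?_
  exact CellPairs.finrank_vectorSpan_lt (fun z hz => hz.1) l
    (fun z hz => le_antisymm (hl z hz.1) (hz.2 x hxF)) ⟨x, hxF, hl⟩ hcon

end Faces

/-! ### Open cells: covering, incidence and finiteness. -/

section Cells

open Set

variable {E : Type*} [NormedAddCommGroup E] [NormedSpace ℝ E]
  {Δ : Set E} {Γ : Geometry.SimplicialComplex ℝ E} {N : Finset E} {c : E → ℝ}

theorem mem_face_of_point_mem (hN : ∀ τ ∈ Γ.faces, τ ⊆ N) (hΓ : Γ.space = Δ) {F : Set E}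
    (hF : IsExposed ℝ Δ F) (hc : c ∈ coordSet Γ) (h : point N c ∈ F) : ∀ u, c u ≠ 0 → u ∈ F := by
  obtain ⟨τ, hτ, hcτ, h1⟩ := exists_support hc
  have hτ0 : ∀ u ∉ τ, c u = 0 := fun u hu => by_contra fun h => hu ((hcτ u).2 h)
  rw [point_eq_of_subset (hN τ hτ) hτ0] at h
  obtain ⟨l, rfl⟩ := hF ⟨_, h⟩
  have hτΔ : ∀ u ∈ τ, u ∈ Δ := fun u hu => hΓ ▸ Γ.subset_space hτ hu
  intro u hu
  have huτ := (hcτ u).2 hu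
  have := eq_of_sum_smul_eq_max (fun u _ => hc.1 u) h1 (fun u hu => h.2 u (hτΔ u hu)) le_rfl u huτ hu
  exact ⟨hτΔ u huτ, fun y hy => this ▸ h.2 y hy⟩

theorem point_mem_of_support_subset (hN : ∀ τ ∈ Γ.faces, τ ⊆ N) {F : Set E} (hF : Convex ℝ F)
    (hc : c ∈ coordSet Γ) (h : ∀ u, c u ≠ 0 → u ∈ F) : point N c ∈ F := by
  obtain ⟨τ, hτ, hcτ, h1⟩ := exists_support hc
  have hτ0 : ∀ u ∉ τ, c u = 0 := fun u hu => by_contra fun h => hu ((hcτ u).2 h)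
  rw [point_eq_of_subset (hN τ hτ) hτ0]
  exact hF.sum_mem (fun u _ => hc.1 u) h1 fun u hu => h u ((hcτ u).1 hu)

/-- The barycentric coordinates of the points of the open cell of `(F, σ)`. -/
def Xi.openCoords (N : Finset E) (x : Xi Δ Γ) : Set (E → ℝ) :=
  {c ∈ coordSet Γ | point N c ∈ supportInterior x.face ∧ ∀ v, v ∈ x.simplex.1 ↔ ∀ u, c u ≤ c v}

theorem Xi.isExposed (x : Xi Δ Γ) : IsExposed ℝ Δ x.face := x.1.1.2.2

theorem Xi.simplex_subset (x : Xi Δ Γ) : (x.simplex.1 : Set E) ⊆ x.face :=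
  (subset_convexHull ℝ _).trans x.2

theorem Xi.simplex_nonempty (x : Xi Δ Γ) : x.simplex.1.Nonempty :=
  Γ.nonempty_of_mem_faces x.simplex.2

theorem Xi.le_iff {x y : Xi Δ Γ} :
    x ≤ y ↔ x.face ⊆ y.face ∧ y.simplex.1 ⊆ x.simplex.1 := Iff.rfl

theorem Xi.openCoords_subset (hN : ∀ τ ∈ Γ.faces, τ ⊆ N) (hΓ : Γ.space = Δ) (x : Xi Δ Γ) :
    x.openCoords N ⊆ x.coords := fun _ hc =>
  ⟨hc.1, mem_face_of_point_mem hN hΓ x.isExposed hc.1 hc.2.1.1, fun v hv => (hc.2.2 v).1 hv⟩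

/-- A face of `Δ` meeting the relative interior of `x.face` contains it, and every vertex of
`y.simplex` maximizes `c`, hence belongs to the full maximizing set `x.simplex`. -/
theorem Xi.le_of_mem (hN : ∀ τ ∈ Γ.faces, τ ⊆ N) (hΔ : Convex ℝ Δ) {x y : Xi Δ Γ}
    (hx : c ∈ x.openCoords N) (hy : c ∈ y.coords) : x ≤ y := by
  refine Xi.le_iff.2 ⟨?_, fun v hv => (hx.2.2 v).2 (hy.2.2 v hv)⟩
  exact subset_of_mem_supportInterior hx.2.1 x.isExposed.subset y.isExposed
    (point_mem_of_support_subset hN (y.isExposed.convex hΔ) hy.1 hy.2.1)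

theorem Xi.coords_mono {x y : Xi Δ Γ} (h : x ≤ y) : x.coords ⊆ y.coords := fun _ hc =>
  ⟨hc.1, fun u hu => (Xi.le_iff.1 h).1 (hc.2.1 u hu), fun v hv => hc.2.2 v ((Xi.le_iff.1 h).2 hv)⟩

theorem exists_mem_openCoords [FiniteDimensional ℝ E] (hN : ∀ τ ∈ Γ.faces, τ ⊆ N)
    (hΓ : Γ.space = Δ) (hΔ : IsPolytope Δ) (hc : c ∈ coordSet Γ) :
    ∃ x : Xi Δ Γ, c ∈ x.openCoords N := by
  classical
  have hconv : Convex ℝ Δ := by obtain ⟨V, rfl⟩ := hΔ; exact convex_convexHull ℝ _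
  obtain ⟨τ, hτ, hcτ, h1⟩ := exists_support hc
  have hp : point N c ∈ Δ := point_mem_of_support_subset hN hconv hc fun u hu =>
    hΓ ▸ Γ.subset_space hτ ((hcτ u).2 hu)
  obtain ⟨F, hF⟩ := hΔ.exists_face hp
  have hmax : ∀ v, (∀ u ∈ τ, c u ≤ c v) ↔ ∀ u, c u ≤ c v := by
    refine fun v => ⟨fun h u => ?_, fun h u _ => h u⟩
    by_cases hu : u ∈ τ
    · exact h u hu
    · rw [by_contra fun h => hu ((hcτ u).2 h)]
      exact hc.1 v
  obtain ⟨v₀, hv₀, hv₀m⟩ := τ.exists_max_image c (Γ.nonempty_of_mem_faces hτ)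
  have hsub := Finset.filter_subset (fun v => ∀ u ∈ τ, c u ≤ c v) τ
  refine ⟨⟨(F, OrderDual.toDual ⟨τ.filter fun v => ∀ u ∈ τ, c u ≤ c v, Γ.down_closed hτ hsub
    ⟨v₀, Finset.mem_filter.2 ⟨hv₀, hv₀m⟩⟩⟩), ?_⟩, hc, hF, fun v => ?_⟩
  · refine convexHull_min (fun u hu => ?_) (F.2.2.convex hconv)
    exact mem_face_of_point_mem hN hΓ F.2.2 hc hF.1 u ((hcτ u).1 (hsub hu))
  · change v ∈ τ.filter _ ↔ _
    rw [Finset.mem_filter, hmax]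
    refine ⟨fun h => h.2, fun h => ⟨(hcτ v).2 ?_, h⟩⟩
    obtain ⟨u, hu⟩ := exists_coord_pos hc
    exact (hu.trans_le (h u)).ne'

/-- A face is determined by the vertices of `Γ` that it contains, and these form a subset of the
finite set `N`. -/
theorem finite_fac (hfin : Γ.faces.Finite) (hΓ : Γ.space = Δ) (hΔ : Convex ℝ Δ) :
    Finite (Fac Δ) := by
  classical
  let N : Finset E := hfin.toFinset.biUnion id
  have hN : ∀ τ ∈ Γ.faces, τ ⊆ N := fun τ hτ =>
    Finset.subset_biUnion_of_mem id (hfin.mem_toFinset.2 hτ)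
  have key : ∀ F G : Fac Δ, F.1 ∩ N ⊆ G.1 → F.1 ⊆ G.1 := by
    intro F G h p hp
    obtain ⟨c, hc, rfl⟩ := exists_coord hN (hΓ.symm ▸ F.2.2.subset hp)
    refine point_mem_of_support_subset hN (G.2.2.convex hΔ) hc fun u hu => h ⟨?_, ?_⟩
    · exact mem_face_of_point_mem hN hΓ F.2.2 hc hp u hu
    · exact by_contra fun h => hu (coord_eq_zero hN hc h)
  have hfinN : Finite (𝒫 (N : Set E)) := (N.finite_toSet.finite_subsets)
  refine Finite.of_injective (β := 𝒫 (N : Set E)) (fun F => ⟨F.1 ∩ N, inter_subset_right⟩) ?_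
  intro F G h
  have h : F.1 ∩ (N : Set E) = G.1 ∩ N := congrArg Subtype.val h
  exact Subtype.ext (Subset.antisymm (key F G (h ▸ inter_subset_left))
    (key G F (h.symm ▸ inter_subset_left)))

theorem finite_xi (hfin : Γ.faces.Finite) (hΓ : Γ.space = Δ) (hΔ : Convex ℝ Δ) :
    Finite (Xi Δ Γ) := by
  have := finite_fac hfin hΓ hΔ
  have : Finite (Γ.faces)ᵒᵈ := hfin
  exact Subtype.finite

end Cells

/-! ### Linear projections along a simplex. -/

section Projection

open Set

/-- Identify `V / S` with `ℝ^d` by dimension and extend the quotient map from `V` to the whole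
space. -/
theorem exists_projection {E : Type*} [AddCommGroup E] [Module ℝ E] [FiniteDimensional ℝ E]
    {S V : Submodule ℝ E} (h : S ≤ V) {d : ℕ}
    (hd : d + Module.finrank ℝ S = Module.finrank ℝ V) :
    ∃ π : E →ₗ[ℝ] (Fin d → ℝ), (∀ v ∈ V, π v = 0 → v ∈ S) ∧ (∀ v ∈ S, π v = 0) ∧
      V.map π = ⊤ := by
  let S' := S.comap V.subtype
  have hS' : Module.finrank ℝ S' = Module.finrank ℝ S :=
    (Submodule.comapSubtypeEquivOfLe h).finrank_eq
  have hq := S'.finrank_quotient_add_finrank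
  have hq' : Module.finrank ℝ (V ⧸ S') = Module.finrank ℝ (Fin d → ℝ) := by
    rw [Module.finrank_fin_fun]; omega
  let e := LinearEquiv.ofFinrankEq _ _ hq'
  obtain ⟨π, hπ⟩ := LinearMap.exists_extend (e.toLinearMap ∘ₗ S'.mkQ)
  have hπ' : ∀ v : V, π v = e (S'.mkQ v) := fun v => LinearMap.congr_fun hπ v
  have hz : ∀ v : V, π v = 0 ↔ (v : E) ∈ S := fun v => by
    rw [hπ', map_eq_zero_iff e e.injective, Submodule.mkQ_apply, Submodule.Quotient.mk_eq_zero]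
    rfl
  refine ⟨π, fun v hv h0 => (hz ⟨v, hv⟩).1 h0, fun v hv => (hz ⟨v, h hv⟩).2 hv, ?_⟩
  refine eq_top_iff.2 fun y _ => ?_
  obtain ⟨v, hv⟩ := S'.mkQ_surjective (e.symm y)
  exact ⟨v, v.2, by rw [hπ', hv, e.apply_symm_apply]⟩

theorem exists_weights_of_mem_vectorSpan {E : Type*} [AddCommGroup E] [Module ℝ E]
    {σ : Finset E} {y : E} (hy : y ∈ vectorSpan ℝ (σ : Set E)) :
    ∃ s : E → ℝ, ∑ u ∈ σ, s u = 0 ∧ ∑ u ∈ σ, s u • u = y := by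
  classical
  rw [vectorSpan_def] at hy
  induction hy using Submodule.span_induction with
  | mem y hy =>
    obtain ⟨a, ha, b, hb, rfl⟩ := hy
    rw [Finset.mem_coe] at ha hb
    refine ⟨fun u => (if u = a then 1 else 0) - if u = b then 1 else 0, ?_, ?_⟩
    · simp [ha, hb]
    · simp [sub_smul, ite_smul, ha, hb]
  | zero => exact ⟨0, by simp, by simp⟩
  | add y z _ _ hy hz =>
    obtain ⟨s, h1, h2⟩ := hy
    obtain ⟨t, h3, h4⟩ := hz
    exact ⟨s + t, by simp [Finset.sum_add_distrib, h1, h3],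
      by simp [Finset.sum_add_distrib, add_smul, h2, h4]⟩
  | smul a y _ hy =>
    obtain ⟨s, h1, h2⟩ := hy
    exact ⟨a • s, by simp [← Finset.mul_sum, h1], by simp [mul_smul, ← Finset.smul_sum, h2]⟩

end Projection

/-! ### The projected tangent cone of a face and its interior. -/

section Cone

open Set Metric Topology

variable {E : Type*} [NormedAddCommGroup E] [NormedSpace ℝ E] {d : ℕ}

/-- The projection of the cone spanned by `F` at its point `b`. -/
def projCone (F : Set E) (b : E) (π : E →ₗ[ℝ] (Fin d → ℝ)) : Set (Fin d → ℝ) :=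
  {z | ∃ ε : ℝ, 0 < ε ∧ ∃ p ∈ F, ε • z = π (p - b)}

variable {F : Set E} {b : E} {π : E →ₗ[ℝ] (Fin d → ℝ)}

theorem mem_projCone {p : E} (hp : p ∈ F) : π (p - b) ∈ projCone F b π :=
  ⟨1, one_pos, p, hp, one_smul _ _⟩

theorem smul_mem_projCone {z : Fin d → ℝ} (hz : z ∈ projCone F b π) {r : ℝ} (hr : 0 < r) :
    r • z ∈ projCone F b π := by
  obtain ⟨ε, hε, p, hp, h⟩ := hz
  exact ⟨ε / r, by positivity, p, hp, by rw [smul_smul, div_mul_cancel₀ _ hr.ne', h]⟩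

theorem convex_projCone (hF : Convex ℝ F) : Convex ℝ (projCone F b π) := by
  rintro z ⟨ε, hε, p, hp, h⟩ z' ⟨ε', hε', p', hp', h'⟩ α β hα hβ hαβ
  have hz : z = ε⁻¹ • π (p - b) := by rw [← h, inv_smul_smul₀ hε.ne']
  have hz' : z' = ε'⁻¹ • π (p' - b) := by rw [← h', inv_smul_smul₀ hε'.ne']
  have hpos : 0 < α * ε⁻¹ + β * ε'⁻¹ := by
    rcases hα.eq_or_lt with rfl | hα
    · rw [zero_add] at hαβ; subst hαβ; positivity
    · positivity
  -- An element of the cone is `ε⁻¹ • π (p - b)`; `D` is the total of the combined coefficients, and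
  -- dividing by it gives a convex combination of `p` and `p'`.
  set D := α * ε⁻¹ + β * ε'⁻¹
  refine ⟨D⁻¹, by positivity, (α * ε⁻¹ / D) • p + (β * ε'⁻¹ / D) • p',
    hF hp hp' (by positivity) (by positivity) (by rw [← add_div, div_self hpos.ne']), ?_⟩
  have hb : (α * ε⁻¹ / D) • p + (β * ε'⁻¹ / D) • p' - b =
      (α * ε⁻¹ / D) • (p - b) + (β * ε'⁻¹ / D) • (p' - b) := by
    have : b = (α * ε⁻¹ / D) • b + (β * ε'⁻¹ / D) • b := by
      rw [← add_smul, ← add_div, div_self hpos.ne', one_smul]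
    rw [smul_sub, smul_sub]
    nth_rewrite 1 [this]
    abel
  rw [hb, map_add, map_smul, map_smul, hz, hz', smul_add, smul_smul, smul_smul, smul_smul,
    smul_smul]
  congr 2 <;> ring

/-- The cone contains `0` and all `π (p - b)`, which span `ℝ^d` because the directions of `F` map
onto it. -/
theorem interior_projCone_nonempty (hF : Convex ℝ F) (hb : b ∈ F)
    (hπ : (vectorSpan ℝ F).map π = ⊤) : (interior (projCone F b π)).Nonempty := by
  rw [(convex_projCone hF).interior_nonempty_iff_affineSpan_eq_top]
  have h0 : (0 : Fin d → ℝ) ∈ projCone F b π := by simpa using mem_projCone (π := π) (b := b) hb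
  rw [AffineSubspace.affineSpan_eq_top_iff_vectorSpan_eq_top_of_nonempty ℝ _ _ ⟨0, h0⟩,
    eq_top_iff, ← hπ, vectorSpan_eq_span_vsub_set_right ℝ hb, Submodule.map_span, Submodule.span_le]
  rintro _ ⟨_, ⟨p, hp, rfl⟩, rfl⟩
  have := vsub_mem_vectorSpan ℝ (mem_projCone (π := π) (b := b) hp) h0
  simpa using this

/-- Otherwise a separating form `m` pulls back to a form supporting `F` at `p`. It is then constant
on `F`, so `m` vanishes on `ℝ^d`, contradicting strict separation from the interior. -/
theorem mem_interior_projCone_of_mem_supportInterior [FiniteDimensional ℝ E] (hF : Convex ℝ F)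
    (hb : b ∈ F) (hπ : (vectorSpan ℝ F).map π = ⊤) {p : E} (hp : p ∈ supportInterior F) {r : ℝ}
    (hr : 0 < r) : r • π (p - b) ∈ interior (projCone F b π) := by
  by_contra hcon
  have hint := interior_projCone_nonempty hF hb hπ
  have hconv := convex_projCone (b := b) (π := π) hF
  obtain ⟨m, hm⟩ := geometric_hahn_banach_open_point hconv.interior isOpen_interior hcon
  have hle : ∀ y ∈ projCone F b π, m y ≤ m (r • π (p - b)) := by
    have : closure (interior (projCone F b π)) ⊆ {y | m y ≤ m (r • π (p - b))} :=
      closure_minimal (fun y hy => (hm y hy).le) (isClosed_le m.continuous continuous_const)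
    rw [hconv.closure_interior_eq_closure_of_nonempty_interior hint] at this
    exact fun y hy => this (subset_closure hy)
  have hz := smul_mem_projCone (mem_projCone (π := π) (b := b) hp.1) hr
  -- Comparing with twice the point and with `0`, both in the cone, forces the supporting value to
  -- vanish.
  have h0 : m (r • π (p - b)) = 0 := by
    have h1 := hle _ (smul_mem_projCone hz two_pos)
    have h2 := hle 0 (by simpa using mem_projCone (π := π) (b := b) hb)
    rw [map_smul] at h1
    simp only [map_zero, smul_eq_mul] at h1 h2
    linarith
  have hp0 : m (π (p - b)) = 0 := by
    rw [map_smul, smul_eq_mul] at h0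
    exact (mul_eq_zero.1 h0).resolve_left hr.ne'
  let l : StrongDual ℝ E := (m.toLinearMap ∘ₗ π).toContinuousLinearMap
  have hl : ∀ y, l y = m (π y) := fun _ => rfl
  have hconst := hp.2 l fun y hy => by
    have := hle _ (mem_projCone (π := π) (b := b) hy)
    rw [h0] at this
    rw [hl, hl]
    simp only [map_sub] at this hp0
    linarith
  have hzero : ∀ y, m y = 0 := by
    intro y
    have hy : y ∈ (vectorSpan ℝ F).map π := hπ ▸ Submodule.mem_top
    obtain ⟨v, hv, rfl⟩ := hy
    have hker : vectorSpan ℝ F ≤ LinearMap.ker (m.toLinearMap ∘ₗ π) := by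
      rw [vectorSpan_def, Submodule.span_le]
      rintro _ ⟨y, hy, z, hz, rfl⟩
      have := (hconst y hy).trans (hconst z hz).symm
      rw [hl, hl] at this
      simp [this]
    exact hker hv
  obtain ⟨y, hy⟩ := hint
  have := hm y hy
  rw [hzero, hzero] at this
  exact this.false

/-- A form `l` maximal at `p` is constant on `σ`, so it does not see the kernel of `π` on the
directions of `F`. Interiority allows a small step away from any `y` in `F`; maximality at the
resulting `p'` then gives `l y ≥ l p`. -/
theorem mem_supportInterior_of_mem_interior_projCone {σ : Finset E} (hbF : b ∈ F)
    (hbσ : b ∈ convexHull ℝ (σ : Set E))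
    (hker : ∀ v ∈ vectorSpan ℝ F, π v = 0 → v ∈ vectorSpan ℝ (σ : Set E))
    {p : E} (hp : p ∈ F)
    (hσ : ∀ l : StrongDual ℝ E, (∀ y ∈ F, l y ≤ l p) → ∀ v ∈ σ, l v = l p) {r : ℝ}
    (h : r • π (p - b) ∈ interior (projCone F b π)) : p ∈ supportInterior F := by
  refine ⟨hp, fun l hl y hy => ?_⟩
  have hlσ := hσ l hl
  have hlb : l b = l p := by
    have : convexHull ℝ (σ : Set E) ⊆ {y | l y = l p} :=
      convexHull_min hlσ (convex_hyperplane l.toLinearMap.isLinear _)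
    exact this hbσ
  have hlS : ∀ v ∈ vectorSpan ℝ (σ : Set E), l v = 0 := by
    have : vectorSpan ℝ (σ : Set E) ≤ LinearMap.ker l.toLinearMap := by
      rw [vectorSpan_def, Submodule.span_le]
      rintro _ ⟨u, hu, v, hv, rfl⟩
      simp [hlσ u hu, hlσ v hv]
    exact this
  have hcont : Continuous fun δ : ℝ => r • π (p - b) - δ • π (y - b) := by fun_prop
  have hev : ∀ᶠ δ in 𝓝 (0 : ℝ), r • π (p - b) - δ • π (y - b) ∈ projCone F b π :=
    hcont.continuousAt.eventually_mem (mem_interior_iff_mem_nhds.1 (by simpa using h))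
  obtain ⟨δ, hδ, hδ0⟩ := ((hev.filter_mono nhdsWithin_le_nhds).and
    (self_mem_nhdsWithin : Ioi (0 : ℝ) ∈ 𝓝[>] 0)).exists
  obtain ⟨ε, hε, p', hp', he⟩ := hδ
  have hv : (ε * r) • (p - b) - (ε * δ) • (y - b) - (p' - b) ∈ vectorSpan ℝ F :=
    sub_mem (sub_mem (Submodule.smul_mem _ _ (vsub_mem_vectorSpan ℝ hp hbF))
      (Submodule.smul_mem _ _ (vsub_mem_vectorSpan ℝ hy hbF))) (vsub_mem_vectorSpan ℝ hp' hbF)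
  have hv0 : π ((ε * r) • (p - b) - (ε * δ) • (y - b) - (p' - b)) = 0 := by
    rw [map_sub, ← he, map_sub, map_smul, map_smul, smul_sub, smul_smul, smul_smul, sub_self]
  have := hlS _ (hker _ hv hv0)
  simp only [map_sub, map_smul, smul_eq_mul, hlb] at this
  have h1 := hl p' hp'
  have h2 := hl y hy
  have hεδ : 0 < ε * δ := by positivity
  have : ε * δ * (l y - l p) = l p - l p' := by linarith
  nlinarith

end Cone

/-! ### Splitting coordinates into those at `σ` and those off `σ`. -/

section Off

open Set

variable {E : Type*} {σ N τ : Finset E} {c d t r : E → ℝ} {a b : ℝ}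

open scoped Classical in
/-- The coordinates `c` with those at the vertices of `σ` replaced by zero. -/
noncomputable def off (σ : Finset E) (c : E → ℝ) : E → ℝ := fun u => if u ∈ σ then 0 else c u

open scoped Classical in
/-- The coordinates `t` with `r` added at the vertices of `σ`. -/
noncomputable def join (σ : Finset E) (t r : E → ℝ) : E → ℝ :=
  fun u => t u + if u ∈ σ then r u else 0

theorem off_of_mem {u : E} (hu : u ∈ σ) : off σ c u = 0 := if_pos hu

theorem off_of_notMem {u : E} (hu : u ∉ σ) : off σ c u = c u := if_neg hu

theorem off_nonneg (hc : ∀ u, 0 ≤ c u) (u : E) : 0 ≤ off σ c u := by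
  unfold off; split_ifs; exacts [le_rfl, hc u]

theorem join_of_notMem {u : E} (hu : u ∉ σ) : join σ t r u = t u := by simp [join, hu]

theorem join_of_mem {u : E} (ht : ∀ u ∈ σ, t u = 0) (hu : u ∈ σ) : join σ t r u = r u := by
  simp [join, hu, ht u hu]

theorem off_join (ht : ∀ u ∈ σ, t u = 0) : off σ (join σ t r) = t := by
  funext u
  by_cases hu : u ∈ σ
  · rw [off_of_mem hu, ht u hu]
  · rw [off_of_notMem hu, join_of_notMem hu]

theorem join_off (c : E → ℝ) : join σ (off σ c) c = c := by
  funext u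
  by_cases hu : u ∈ σ
  · rw [join_of_mem (fun _ => off_of_mem) hu]
  · rw [join_of_notMem hu, off_of_notMem hu]

theorem sum_join (hσ : σ ⊆ N) (t r : E → ℝ) :
    ∑ u ∈ N, join σ t r u = ∑ u ∈ N, t u + ∑ u ∈ σ, r u := by
  classical
  simp only [join, Finset.sum_add_distrib, ← Finset.sum_filter]
  congr 2
  ext u
  simp only [Finset.mem_filter]
  exact ⟨fun h => h.2, fun h => ⟨hσ h, h⟩⟩

/-- The function cutting out the part of the star of `σ` where the coordinates at `σ` dominate. -/
noncomputable def height (σ N : Finset E) (t : E → ℝ) : ℝ :=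
  σ.card * ‖fun u : N => t u‖ + ∑ u ∈ N, t u

theorem height_nonneg (ht : ∀ u, 0 ≤ t u) : 0 ≤ height σ N t :=
  add_nonneg (by positivity) (Finset.sum_nonneg fun u _ => ht u)

theorem height_smul (ha : 0 ≤ a) : height σ N (a • t) = a * height σ N t := by
  have : (fun u : N => (a • t) u) = a • fun u : N => t u := rfl
  rw [height, this, norm_smul, Real.norm_of_nonneg ha, height]
  simp only [Pi.smul_apply, smul_eq_mul, ← Finset.mul_sum]
  ring

theorem height_pos (ht : ∀ u, 0 ≤ t u) (hN : ∀ u ∉ N, t u = 0) (h : t ≠ 0) :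
    0 < height σ N t := by
  obtain ⟨u, hu⟩ := Function.ne_iff.1 h
  have huN : u ∈ N := by_contra fun h => hu (hN u h)
  refine add_pos_of_nonneg_of_pos (by positivity)
    (Finset.sum_pos' (fun u _ => ht u) ⟨u, huN, (ht u).lt_of_ne (Ne.symm hu)⟩)

theorem height_zero : height σ N (0 : E → ℝ) = 0 := by
  have := height_smul (σ := σ) (N := N) (t := (0 : E → ℝ)) (le_refl (0 : ℝ))
  rwa [zero_smul, zero_mul] at this

theorem continuous_off : Continuous (off σ) := by
  refine continuous_pi fun u => ?_
  unfold off
  split_ifs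
  exacts [continuous_const, continuous_apply u]

theorem continuous_height : Continuous (height σ N) := by
  unfold height
  fun_prop

end Off

/-! ### The star of a simplex, and compactness of cells in coordinates. -/

section Star

open Set

variable {E : Type*} [NormedAddCommGroup E] [NormedSpace ℝ E]
  {Δ : Set E} {Γ : Geometry.SimplicialComplex ℝ E} {σ N τ : Finset E} {c t r : E → ℝ}

theorem point_join (hσ : σ ⊆ N) (t r : E → ℝ) :
    point N (join σ t r) = point N t + ∑ u ∈ σ, r u • u := by
  classical
  simp only [point, join, add_smul, Finset.sum_add_distrib, ite_smul, zero_smul,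
    ← Finset.sum_filter]
  congr 2
  ext u
  simp only [Finset.mem_filter]
  exact ⟨fun h => h.2, fun h => ⟨hσ h, h⟩⟩

theorem join_mem_coordSet (hN : ∀ τ ∈ Γ.faces, τ ⊆ N) (hτ : τ ∈ Γ.faces) (hσ : σ ⊆ τ)
    (t0 : ∀ u, 0 ≤ t u) (r0 : ∀ u ∈ σ, 0 ≤ r u) (ht : ∀ u ∉ τ, t u = 0)
    (h1 : ∑ u ∈ N, t u + ∑ u ∈ σ, r u = 1) : join σ t r ∈ coordSet Γ := by
  have h0 : ∀ u ∉ τ, join σ t r u = 0 := fun u hu => by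
    rw [join_of_notMem fun h => hu (hσ h), ht u hu]
  refine ⟨fun u => ?_, τ, hτ, h0, ?_⟩
  · unfold join
    split_ifs with h
    · exact add_nonneg (t0 u) (r0 u h)
    · simpa using t0 u
  · rw [← sum_eq_of_subset (hN τ hτ) h0, sum_join (hσ.trans (hN τ hτ)), h1]

/-- The projections from `σ` of the simplices containing `σ` form a simplicial fan. -/
theorem fan_injective (hN : ∀ τ ∈ Γ.faces, τ ⊆ N) {t t' : E → ℝ} {τ τ' : Finset E}
    (hσne : σ.Nonempty) (hτ : τ ∈ Γ.faces) (hτ' : τ' ∈ Γ.faces) (hσ : σ ⊆ τ) (hσ' : σ ⊆ τ')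
    (t0 : ∀ u, 0 ≤ t u) (t0' : ∀ u, 0 ≤ t' u) (ht : ∀ u ∉ τ, t u = 0) (ht' : ∀ u ∉ τ', t' u = 0)
    (htσ : ∀ u ∈ σ, t u = 0) (htσ' : ∀ u ∈ σ, t' u = 0)
    (h : (point N t - (∑ u ∈ N, t u) • σ.centroid ℝ id) -
      (point N t' - (∑ u ∈ N, t' u) • σ.centroid ℝ id) ∈ vectorSpan ℝ (σ : Set E)) : t = t' := by
  obtain ⟨s, hs, hs'⟩ := exists_weights_of_mem_vectorSpan h
  set T := ∑ u ∈ N, t u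
  set T' := ∑ u ∈ N, t' u
  have T0 : 0 ≤ T := Finset.sum_nonneg fun u _ => t0 u
  have T0' : 0 ≤ T' := Finset.sum_nonneg fun u _ => t0' u
  have k0 : (0 : ℝ) < σ.card := by exact_mod_cast hσne.card_pos
  set k : ℝ := (σ.card : ℝ) with hk
  set A := ∑ u ∈ σ, |s u|
  have A0 : 0 ≤ A := Finset.sum_nonneg fun u _ => abs_nonneg _
  have hsA : ∀ u ∈ σ, |s u| ≤ A := fun u hu =>
    Finset.single_le_sum (f := fun u => |s u|) (fun u _ => abs_nonneg _) hu
  -- So small that, after scaling by `ε`, the coefficients left for the vertices of `σ` are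
  -- nonnegative in both representations below, even after the correction `ε * s u`.
  set ε := (1 + T + T' + k * A)⁻¹ with hε
  have D0 : 0 < 1 + T + T' + k * A := by positivity
  have ε0 : 0 < ε := by positivity
  have hεD : ε * (1 + T + T' + k * A) = 1 := inv_mul_cancel₀ D0.ne'
  have sm : ∀ t : E → ℝ, ∑ u ∈ N, (ε • t) u = ε * ∑ u ∈ N, t u := fun t => by
    simp [Finset.mul_sum]
  have pm : ∀ t : E → ℝ, point N (ε • t) = ε • point N t := fun t => by
    simp [point, mul_smul, Finset.smul_sum]
  have e : join σ (ε • t) (fun _ => (1 - ε * T) / k) ∈ coordSet Γ := by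
    refine join_mem_coordSet hN hτ hσ (fun u => mul_nonneg ε0.le (t0 u)) (fun u _ => ?_)
      (fun u hu => by simp [ht u hu]) ?_
    · refine div_nonneg ?_ k0.le
      have : 0 ≤ ε * (1 + T' + k * A) := by positivity
      linarith
    · rw [sm, Finset.sum_const, nsmul_eq_mul, ← hk]
      field_simp
      ring
  have e' : join σ (ε • t') (fun u => (1 - ε * T') / k + ε * s u) ∈ coordSet Γ := by
    refine join_mem_coordSet hN hτ' hσ' (fun u => mul_nonneg ε0.le (t0' u)) (fun u hu => ?_)
      (fun u hu => by simp [ht' u hu]) ?_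
    · have h1 : -A ≤ s u := (neg_le_neg (hsA u hu)).trans (neg_abs_le _)
      have h2 : (1 - ε * T') / k + ε * s u = ((1 - ε * T') + ε * (k * s u)) / k := by
        field_simp
      rw [h2]
      refine div_nonneg ?_ k0.le
      have h3 : ε * (k * (-A)) ≤ ε * (k * s u) := by gcongr
      have h4 : 0 ≤ ε * (1 + T) := by positivity
      linarith
    · rw [sm, Finset.sum_add_distrib, Finset.sum_const, nsmul_eq_mul, ← hk, ← Finset.mul_sum, hs]
      field_simp
      ring
  have hc : ∀ a : ℝ, ∑ u ∈ σ, (a / k) • u = a • σ.centroid ℝ id := fun a => by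
    rw [centroid_eq_sum hσne, Finset.smul_sum]
    exact Finset.sum_congr rfl fun u _ => by rw [smul_smul, div_eq_mul_inv]
  have hσN := hσ.trans (hN τ hτ)
  -- Both coordinate systems describe the barycenter of `σ` moved by `ε` times the displacement
  -- given by `t`; the weights `s` absorb the discrepancy along `σ`.
  have heq := point_injOn hN e e' (by
    rw [point_join hσN, point_join hσN, pm, pm]
    simp only [add_smul, Finset.sum_add_distrib, hc, mul_smul, ← Finset.smul_sum, hs']
    module)
  have := congrArg (off σ) heq
  rw [off_join fun u hu => by simp [htσ u hu], off_join fun u hu => by simp [htσ' u hu]] at this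
  exact smul_right_injective _ ε0.ne' this

/-- Points near the barycenter of `σ` lie in simplices containing `σ`. -/
theorem eventually_subset_of_mem_convexHull (hN : ∀ τ ∈ Γ.faces, τ ⊆ N) (hfin : Γ.faces.Finite)
    (hσ : σ ∈ Γ.faces) : ∀ᶠ p in nhds (σ.centroid ℝ id),
      ∀ τ ∈ Γ.faces, p ∈ convexHull ℝ (τ : Set E) → σ ⊆ τ := by
  classical
  rw [hfin.eventually_all]
  intro τ hτ
  by_cases hστ : σ ⊆ τ
  · exact Filter.Eventually.of_forall fun _ _ => hστ
  have hne := Γ.nonempty_of_mem_faces hσ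
  have hk : (σ.card : ℝ) ≠ 0 := by exact_mod_cast hne.card_ne_zero
  have hnot : σ.centroid ℝ id ∉ convexHull ℝ (τ : Set E) := by
    intro h
    obtain ⟨c, hc, hcτ, hcp⟩ := exists_coord_of_mem hN hτ h
    have hb : join σ 0 (fun _ => (σ.card : ℝ)⁻¹) ∈ coordSet Γ :=
      join_mem_coordSet hN hσ subset_rfl (fun _ => le_rfl) (fun _ _ => by positivity)
        (fun _ _ => rfl) (by simp [hk])
    have := point_injOn hN hc hb (by
      rw [hcp, point_join (hN σ hσ), centroid_eq_sum hne]; simp [point])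
    refine hστ fun u hu => by_contra fun hu' => ?_
    have h1 := congrFun this u
    rw [hcτ u hu', join_of_mem (t := 0) (fun _ _ => rfl) hu] at h1
    exact inv_ne_zero hk h1.symm
  have hcl : IsClosed (convexHull ℝ (τ : Set E)) := (τ.finite_toSet.isCompact_convexHull ℝ).isClosed
  filter_upwards [hcl.isOpen_compl.mem_nhds hnot] with p hp hp'
  exact absurd hp' hp

/-- Coordinates carry the product topology of `E → ℝ`; the set is closed, as a finite union over
simplices, inside a product of unit intervals. -/
theorem isCompact_coordSet (hfin : Γ.faces.Finite) : IsCompact (coordSet Γ) := by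
  have hcl : IsClosed (coordSet Γ) := by
    have : coordSet Γ = {c | ∀ u, 0 ≤ c u} ∩
        ⋃ τ ∈ Γ.faces, {c | (∀ u ∉ τ, c u = 0) ∧ ∑ u ∈ τ, c u = 1} := by
      ext c
      simp only [coordSet, mem_inter_iff, mem_iUnion, mem_ofPred_eq, exists_prop]
    rw [this]
    refine IsClosed.inter ?_ (hfin.isClosed_biUnion fun τ _ => IsClosed.inter ?_ ?_)
    · simp only [ofPred_forall]
      exact isClosed_iInter fun u => isClosed_le continuous_const (continuous_apply u)
    · have : {c : E → ℝ | ∀ u ∉ τ, c u = 0} = ⋂ u, ⋂ _ : u ∉ τ, {c | c u = 0} := by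
        ext c; simp
      change IsClosed {c : E → ℝ | ∀ u ∉ τ, c u = 0}
      rw [this]
      exact isClosed_iInter fun u => isClosed_iInter fun _ =>
        isClosed_eq (continuous_apply u) continuous_const
    · exact isClosed_eq (by fun_prop) continuous_const
  refine (isCompact_univ_pi fun _ : E => isCompact_Icc (a := (0 : ℝ)) (b := 1)).of_isClosed_subset
    hcl fun c hc u _ => ⟨hc.1 u, ?_⟩
  obtain ⟨h0, τ, -, h, h1⟩ := hc
  by_cases hu : u ∈ τ
  · rw [← h1]; exact Finset.single_le_sum (fun u _ => h0 u) hu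
  · rw [h u hu]; exact zero_le_one

theorem Xi.isCompact_coords (hfin : Γ.faces.Finite) (x : Xi Δ Γ) : IsCompact x.coords := by
  refine (isCompact_coordSet hfin).inter_right (IsClosed.inter ?_ ?_)
  · have : {c : E → ℝ | ∀ u, c u ≠ 0 → u ∈ x.face} = ⋂ u, ⋂ _ : u ∉ x.face, {c | c u = 0} := by
      ext c; simp [not_imp_comm]
    change IsClosed {c : E → ℝ | ∀ u, c u ≠ 0 → u ∈ x.face}
    rw [this]
    exact isClosed_iInter fun u => isClosed_iInter fun _ =>
      isClosed_eq (continuous_apply u) continuous_const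
  · change IsClosed {c : E → ℝ | ∀ v ∈ x.simplex.1, ∀ u, c u ≤ c v}
    simp only [ofPred_forall]
    exact isClosed_iInter fun v => isClosed_iInter fun _ => isClosed_iInter fun u =>
      isClosed_le (continuous_apply u) (continuous_apply v)

theorem continuous_point : Continuous (point N) := by
  unfold point
  fun_prop

end Star

/-! ### Identification of a cell with a convex body. -/

section BallMap

open Set Metric

variable {E : Type*} [NormedAddCommGroup E] [NormedSpace ℝ E]
  {Δ : Set E} {Γ : Geometry.SimplicialComplex ℝ E} {N : Finset E} {c c' : E → ℝ} {d : ℕ}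

/-- The linear map `π` is a projection along the simplex `σ` of the linear span of the
face `F`, for the cell pair `x = (F, σ)`. -/
structure Xi.IsProj (x : Xi Δ Γ) (π : E →ₗ[ℝ] (Fin d → ℝ)) : Prop where
  mem_of_eq_zero : ∀ v ∈ vectorSpan ℝ x.face, π v = 0 → v ∈ vectorSpan ℝ (x.simplex.1 : Set E)
  eq_zero_of_mem : ∀ v ∈ vectorSpan ℝ (x.simplex.1 : Set E), π v = 0
  map_eq_top : (vectorSpan ℝ x.face).map π = ⊤

/-- The barycenter of the simplex of a cell pair. -/
noncomputable def Xi.center (x : Xi Δ Γ) : E := x.simplex.1.centroid ℝ id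

/-- The position of a point relative to the barycenter of `σ`, projected along `σ`. -/
noncomputable def Xi.proj (N : Finset E) (x : Xi Δ Γ) (π : E →ₗ[ℝ] (Fin d → ℝ)) (c : E → ℝ) :
    Fin d → ℝ := π (point N c - x.center)

/-- The radial rescaling of the projection of `C(F, σ)` to the unit ball. -/
noncomputable def Xi.rescale (N : Finset E) (x : Xi Δ Γ) (π : E →ₗ[ℝ] (Fin d → ℝ)) (c : E → ℝ) :
    Fin d → ℝ :=
  (height x.simplex.1 N (off x.simplex.1 c) / ‖x.proj N π c‖) • x.proj N π c

variable {x : Xi Δ Γ} {π : E →ₗ[ℝ] (Fin d → ℝ)}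

theorem Xi.center_mem_convexHull (x : Xi Δ Γ) :
    x.center ∈ convexHull ℝ (x.simplex.1 : Set E) :=
  x.simplex.1.centroid_mem_convexHull x.simplex_nonempty

theorem Xi.center_mem (x : Xi Δ Γ) : x.center ∈ x.face := x.2 x.center_mem_convexHull

theorem Xi.sub_center_mem (x : Xi Δ Γ) {u : E} (hu : u ∈ x.simplex.1) :
    u - x.center ∈ vectorSpan ℝ (x.simplex.1 : Set E) := by
  rw [← direction_affineSpan]
  exact AffineSubspace.vsub_mem_direction (subset_affineSpan ℝ _ hu)
    (convexHull_subset_affineSpan _ x.center_mem_convexHull)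

theorem Xi.point_mem (hN : ∀ τ ∈ Γ.faces, τ ⊆ N) (hΔ : Convex ℝ Δ) (hc : c ∈ x.coords) :
    point N c ∈ x.face :=
  point_mem_of_support_subset hN (x.isExposed.convex hΔ) hc.1 hc.2.1

theorem Xi.coords_pos (hc : c ∈ x.coords) {v : E} (hv : v ∈ x.simplex.1) : 0 < c v := by
  obtain ⟨u, hu⟩ := exists_coord_pos hc.1
  exact hu.trans_le (hc.2.2 v hv u)

theorem Xi.exists_simplex (hc : c ∈ coordSet Γ) (hσ : ∀ v ∈ x.simplex.1, 0 < c v) :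
    ∃ τ ∈ Γ.faces, x.simplex.1 ⊆ τ ∧ ∀ u ∉ τ, c u = 0 := by
  obtain ⟨τ, hτ, h, -⟩ := exists_support hc
  exact ⟨τ, hτ, fun v hv => (h v).2 (hσ v hv).ne', fun u hu => by_contra fun h' => hu ((h u).2 h')⟩

/-- The difference is the sum of `c u • (u - x.center)` over the vertices `u` of `σ`. Hence, modulo
the directions of `σ`, the position of a point depends only on its coordinates off `σ`. -/
theorem Xi.point_sub_center_sub_mem (hN : ∀ τ ∈ Γ.faces, τ ⊆ N) (x : Xi Δ Γ)
    (hc : c ∈ coordSet Γ) :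
    point N c - x.center - (point N (off x.simplex.1 c) -
      (∑ u ∈ N, off x.simplex.1 c u) • x.center) ∈ vectorSpan ℝ (x.simplex.1 : Set E) := by
  have hσ := hN _ x.simplex.2
  have h1 := sum_coordSet hN hc
  have hp := point_join hσ (off x.simplex.1 c) c
  have hs := sum_join hσ (off x.simplex.1 c) c
  rw [join_off] at hp hs
  have : point N c - x.center - (point N (off x.simplex.1 c) -
      (∑ u ∈ N, off x.simplex.1 c u) • x.center) =
      ∑ u ∈ x.simplex.1, c u • (u - x.center) := by
    have hT : ∑ u ∈ N, off x.simplex.1 c u = 1 - ∑ u ∈ x.simplex.1, c u := by linarith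
    rw [hp, hT]
    simp only [smul_sub, Finset.sum_sub_distrib, ← Finset.sum_smul]
    module
  rw [this]
  exact sum_mem fun u hu => Submodule.smul_mem _ _ (x.sub_center_mem hu)

/-- This is `fan_injective` read through `π`. The factors may vanish: `a = 1`, `a' = 0` shows that
the projection is zero only when the coordinates off `σ` are. -/
theorem Xi.IsProj.off_eq (hπ : x.IsProj π) (hN : ∀ τ ∈ Γ.faces, τ ⊆ N) (hc : c ∈ coordSet Γ)
    (hc' : c' ∈ coordSet Γ) (hσ : ∀ v ∈ x.simplex.1, 0 < c v) (hσ' : ∀ v ∈ x.simplex.1, 0 < c' v)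
    (hF : point N c ∈ x.face) (hF' : point N c' ∈ x.face) {a a' : ℝ} (ha : 0 ≤ a) (ha' : 0 ≤ a')
    (h : a • x.proj N π c = a' • x.proj N π c') :
    a • off x.simplex.1 c = a' • off x.simplex.1 c' := by
  obtain ⟨τ, hτ, hστ, hcτ⟩ := Xi.exists_simplex hc hσ
  obtain ⟨τ', hτ', hστ', hcτ'⟩ := Xi.exists_simplex hc' hσ'
  have h1 := x.point_sub_center_sub_mem hN hc
  have h2 := x.point_sub_center_sub_mem hN hc'
  have h3 : a • (point N c - x.center) - a' • (point N c' - x.center) ∈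
      vectorSpan ℝ (x.simplex.1 : Set E) := by
    refine hπ.mem_of_eq_zero _ (sub_mem
      (Submodule.smul_mem _ _ (vsub_mem_vectorSpan ℝ hF x.center_mem))
      (Submodule.smul_mem _ _ (vsub_mem_vectorSpan ℝ hF' x.center_mem))) ?_
    rw [map_sub, map_smul, map_smul, sub_eq_zero]
    exact h
  refine fan_injective hN x.simplex_nonempty hτ hτ' hστ hστ'
    (fun u => mul_nonneg ha (off_nonneg hc.1 u)) (fun u => mul_nonneg ha' (off_nonneg hc'.1 u))
    (fun u hu => ?_) (fun u hu => ?_) (fun u hu => ?_) (fun u hu => ?_) ?_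
  · simp [off_of_notMem fun h => hu (hστ h), hcτ u hu]
  · simp [off_of_notMem fun h => hu (hστ' h), hcτ' u hu]
  · simp [off_of_mem hu]
  · simp [off_of_mem hu]
  · have sm : ∀ (r : ℝ) (t : E → ℝ), ∑ u ∈ N, (r • t) u = r * ∑ u ∈ N, t u := fun r t => by
      simp [Finset.mul_sum]
    have pm : ∀ (r : ℝ) (t : E → ℝ), point N (r • t) = r • point N t := fun r t => by
      simp [point, mul_smul, Finset.smul_sum]
    have := add_mem (sub_mem h3 (Submodule.smul_mem _ a h1)) (Submodule.smul_mem _ a' h2)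
    rw [sm, sm, pm, pm, show x.simplex.1.centroid ℝ id = x.center from rfl]
    convert this using 1
    module

theorem Xi.proj_eq_zero_of_off (hπ : x.IsProj π) (hN : ∀ τ ∈ Γ.faces, τ ⊆ N)
    (hc : c ∈ coordSet Γ) (h : off x.simplex.1 c = 0) : x.proj N π c = 0 := by
  have := x.point_sub_center_sub_mem hN hc
  rw [h] at this
  simp only [point, Pi.zero_apply, zero_smul, Finset.sum_const_zero, sub_zero] at this
  exact hπ.eq_zero_of_mem _ this

theorem Xi.off_eq_zero_of_proj (hπ : x.IsProj π) (hN : ∀ τ ∈ Γ.faces, τ ⊆ N)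
    (hΔ : Convex ℝ Δ) (hc : c ∈ x.coords) (h : x.proj N π c = 0) : off x.simplex.1 c = 0 := by
  have hp := Xi.point_mem hN hΔ hc
  have := hπ.off_eq hN hc.1 hc.1 (fun v => Xi.coords_pos hc) (fun v => Xi.coords_pos hc) hp hp
    zero_le_one le_rfl (by simp [h])
  simpa using this

theorem Xi.height_off_pos (hN : ∀ τ ∈ Γ.faces, τ ⊆ N) (hc : c ∈ coordSet Γ)
    (h : off x.simplex.1 c ≠ 0) : 0 < height x.simplex.1 N (off x.simplex.1 c) :=
  height_pos (off_nonneg hc.1) (fun u hu => by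
    rw [off_of_notMem fun h => hu (hN _ x.simplex.2 h), coord_eq_zero hN hc hu]) h

theorem Xi.norm_rescale (hπ : x.IsProj π) (hN : ∀ τ ∈ Γ.faces, τ ⊆ N)
    (hΔ : Convex ℝ Δ) (hc : c ∈ x.coords) :
    ‖x.rescale N π c‖ = height x.simplex.1 N (off x.simplex.1 c) := by
  by_cases h : x.proj N π c = 0
  · rw [Xi.off_eq_zero_of_proj hπ hN hΔ hc h, height_zero, Xi.rescale, h, smul_zero, norm_zero]
  · have hn := norm_pos_iff.2 h
    have h0 := height_nonneg (σ := x.simplex.1) (N := N) (off_nonneg (σ := x.simplex.1) hc.1.1)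
    rw [Xi.rescale, norm_smul, Real.norm_of_nonneg (div_nonneg h0 hn.le), div_mul_cancel₀ _ hn.ne']

theorem Xi.exists_rescale_eq (hπ : x.IsProj π) (hN : ∀ τ ∈ Γ.faces, τ ⊆ N)
    (hc : c ∈ x.coords) :
    ∃ r : ℝ, 0 < r ∧ x.rescale N π c = r • x.proj N π c := by
  by_cases h : x.proj N π c = 0
  · exact ⟨1, one_pos, by rw [Xi.rescale, h, smul_zero, smul_zero]⟩
  · refine ⟨_, div_pos (Xi.height_off_pos hN hc.1 fun h' => h ?_) (norm_pos_iff.2 h), rfl⟩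
    exact Xi.proj_eq_zero_of_off hπ hN hc.1 h'

theorem Xi.sum_off (hN : ∀ τ ∈ Γ.faces, τ ⊆ N) (hc : c ∈ x.coords) {v : E}
    (hv : v ∈ x.simplex.1) :
    ∑ u ∈ N, off x.simplex.1 c u + x.simplex.1.card * c v = 1 := by
  have hs := sum_join (hN _ x.simplex.2) (off x.simplex.1 c) c
  rw [join_off, sum_coordSet hN hc.1, Finset.sum_congr rfl fun u hu =>
    le_antisymm (hc.2.2 v hv u) (hc.2.2 u hu v), Finset.sum_const, nsmul_eq_mul] at hs
  exact hs.symm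

/-- Only zeros of the projection are delicate; there the norm of the rescaled vector is squeezed by
the height, which tends to `0`. -/
theorem Xi.continuousOn_rescale [FiniteDimensional ℝ E] (hπ : x.IsProj π)
    (hN : ∀ τ ∈ Γ.faces, τ ⊆ N) (hΔ : Convex ℝ Δ) : ContinuousOn (x.rescale N π) x.coords := by
  have hcp : Continuous (x.proj N π) :=
    π.continuous_of_finiteDimensional.comp (continuous_point.sub continuous_const)
  have hch : Continuous fun c => height x.simplex.1 N (off x.simplex.1 c) :=
    continuous_height.comp continuous_off
  intro c hc
  refine ContinuousAt.continuousWithinAt ?_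
  by_cases h : x.proj N π c = 0
  · have h0 := Xi.off_eq_zero_of_proj hπ hN hΔ hc h
    have hr : x.rescale N π c = 0 := by rw [Xi.rescale, h, smul_zero]
    have hlim := hch.norm.tendsto c
    rw [h0, height_zero, norm_zero] at hlim
    rw [ContinuousAt, hr]
    refine squeeze_zero_norm (fun c => ?_) hlim
    rw [Xi.rescale, norm_smul, norm_div, norm_norm]
    rw [div_mul_eq_mul_div]
    exact div_le_of_le_mul₀ (norm_nonneg _) (norm_nonneg _) le_rfl
  · exact (hch.continuousAt.div hcp.norm.continuousAt (norm_ne_zero_iff.2 h)).smul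
      hcp.continuousAt

/-- The coordinates at `σ` share one value, fixed by the total mass being `1`. -/
theorem Xi.eq_of_off_eq (hN : ∀ τ ∈ Γ.faces, τ ⊆ N) (hc : c ∈ x.coords) (hc' : c' ∈ x.coords)
    (h : off x.simplex.1 c = off x.simplex.1 c') : c = c' := by
  funext u
  by_cases hu : u ∈ x.simplex.1
  · have h1 := Xi.sum_off hN hc hu
    have h2 := Xi.sum_off hN hc' hu
    have hk : (x.simplex.1.card : ℝ) ≠ 0 := by exact_mod_cast x.simplex_nonempty.card_ne_zero
    rw [h] at h1
    exact mul_left_cancel₀ hk (add_left_cancel (h1.trans h2.symm))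
  · rw [← off_of_notMem (c := c) hu, h, off_of_notMem hu]

/-- Equal images have equal heights and projections on the same ray. So the coordinates off `σ` are
proportional, and the equal heights make the factor `1`. -/
theorem Xi.injOn_rescale (hπ : x.IsProj π) (hN : ∀ τ ∈ Γ.faces, τ ⊆ N) (hΔ : Convex ℝ Δ) :
    InjOn (x.rescale N π) x.coords := by
  intro c hc c' hc' h
  have hH : height x.simplex.1 N (off x.simplex.1 c) = height x.simplex.1 N (off x.simplex.1 c') := by
    rw [← Xi.norm_rescale hπ hN hΔ hc, h, Xi.norm_rescale hπ hN hΔ hc']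
  refine Xi.eq_of_off_eq hN hc hc' ?_
  obtain ⟨r, hr, hrc⟩ := Xi.exists_rescale_eq hπ hN hc
  obtain ⟨r', hr', hrc'⟩ := Xi.exists_rescale_eq hπ hN hc'
  have key := hπ.off_eq hN hc.1 hc'.1 (fun v => Xi.coords_pos hc) (fun v => Xi.coords_pos hc')
    (Xi.point_mem hN hΔ hc) (Xi.point_mem hN hΔ hc') hr.le hr'.le (by rw [← hrc, h, hrc'])
  by_cases h0 : off x.simplex.1 c = 0
  · rw [h0, smul_zero] at key
    rw [h0]
    exact ((smul_eq_zero.1 key.symm).resolve_left hr'.ne').symm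
  · have hpos := Xi.height_off_pos hN hc.1 h0
    have := congrArg (height x.simplex.1 N) key
    rw [height_smul hr.le, height_smul hr'.le, ← hH] at this
    rw [mul_right_cancel₀ hpos.ne' this] at key
    exact smul_right_injective _ hr'.ne' key

theorem Xi.norm_off_le (hc : c ∈ x.coords) {v : E} (hv : v ∈ x.simplex.1) :
    ‖fun u : N => off x.simplex.1 c u‖ ≤ c v := by
  refine (pi_norm_le_iff_of_nonneg (Xi.coords_pos hc hv).le).2 fun u => ?_
  rw [Real.norm_of_nonneg (off_nonneg hc.1.1 _)]
  unfold off
  split_ifs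
  exacts [(Xi.coords_pos hc hv).le, hc.2.2 v hv u]

theorem Xi.height_off_le_one (hN : ∀ τ ∈ Γ.faces, τ ⊆ N) (hc : c ∈ x.coords) :
    height x.simplex.1 N (off x.simplex.1 c) ≤ 1 := by
  obtain ⟨v, hv⟩ := x.simplex_nonempty
  rw [← Xi.sum_off hN hc hv, height, add_comm]
  gcongr
  exact Xi.norm_off_le hc hv

/-- By `Xi.sum_off`, height below `1` means that the sup norm off `σ` is strictly below the common
value at `σ`: no further vertex attains the maximum. -/
theorem Xi.height_off_lt_one_iff (hN : ∀ τ ∈ Γ.faces, τ ⊆ N) (hc : c ∈ x.coords) :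
    height x.simplex.1 N (off x.simplex.1 c) < 1 ↔ ∀ v, v ∈ x.simplex.1 ↔ ∀ u, c u ≤ c v := by
  obtain ⟨v, hv⟩ := x.simplex_nonempty
  have hk : (0 : ℝ) < x.simplex.1.card := by exact_mod_cast x.simplex_nonempty.card_pos
  rw [← Xi.sum_off hN hc hv, height, add_comm, add_lt_add_iff_left, mul_lt_mul_iff_right₀ hk,
    pi_norm_lt_iff (Xi.coords_pos hc hv)]
  refine ⟨fun h w => ⟨hc.2.2 w, fun hw => by_contra fun hwσ => ?_⟩, fun h u => ?_⟩
  · have hwN : w ∈ N := by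
      by_contra hwN
      have := hw v
      rw [coord_eq_zero hN hc.1 hwN] at this
      exact (Xi.coords_pos hc hv).not_ge this
    have := h ⟨w, hwN⟩
    rw [Real.norm_of_nonneg (off_nonneg hc.1.1 _), off_of_notMem hwσ] at this
    exact this.not_ge (hw v)
  · rw [Real.norm_of_nonneg (off_nonneg hc.1.1 _)]
    by_cases hu : u.1 ∈ x.simplex.1
    · rw [off_of_mem hu]; exact Xi.coords_pos hc hv
    · rw [off_of_notMem hu]
      refine (hc.2.2 v hv u).lt_of_ne fun heq => hu ((h u).2 fun w => heq ▸ hc.2.2 v hv w)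

theorem Xi.image_rescale (hπ : x.IsProj π) (hN : ∀ τ ∈ Γ.faces, τ ⊆ N) (hfin : Γ.faces.Finite)
    (hΓ : Γ.space = Δ) (hΔ : Convex ℝ Δ) :
    x.rescale N π '' x.coords = projCone x.face x.center π ∩ closedBall 0 1 := by
  refine Subset.antisymm ?_ ?_
  · rintro _ ⟨c, hc, rfl⟩
    obtain ⟨r, hr, h⟩ := Xi.exists_rescale_eq hπ hN hc
    refine ⟨h ▸ smul_mem_projCone (mem_projCone (Xi.point_mem hN hΔ hc)) hr, ?_⟩
    rw [mem_closedBall_zero_iff, Xi.norm_rescale hπ hN hΔ hc]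
    exact Xi.height_off_le_one hN hc
  rintro z ⟨⟨ε, hε, p, hp, hz⟩, hz1⟩
  rw [mem_closedBall_zero_iff] at hz1
  have hFconv := x.isExposed.convex hΔ
  have hk : (0 : ℝ) < x.simplex.1.card := by exact_mod_cast x.simplex_nonempty.card_pos
  -- Moving `p` towards the barycenter of `σ` keeps its projected ray and brings it into simplices
  -- that contain `σ`.
  have hev : ∀ᶠ θ in nhds (0 : ℝ), ∀ τ ∈ Γ.faces,
      x.center + θ • (p - x.center) ∈ convexHull ℝ (τ : Set E) → x.simplex.1 ⊆ τ := by
    have hcont : Continuous fun θ : ℝ => x.center + θ • (p - x.center) := by fun_prop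
    have ht := hcont.tendsto 0
    rw [zero_smul, add_zero] at ht
    exact ht.eventually (eventually_subset_of_mem_convexHull hN hfin x.simplex.2)
  obtain ⟨θ, hθ, hθ0, hθ1⟩ := ((hev.filter_mono nhdsWithin_le_nhds).and
    (Ioo_mem_nhdsGT (zero_lt_one' ℝ))).exists
  have hpF : x.center + θ • (p - x.center) ∈ x.face :=
    hFconv.add_smul_sub_mem x.center_mem hp ⟨hθ0.le, hθ1.le⟩
  have hpΓ : x.center + θ • (p - x.center) ∈ Γ.space := by
    rw [hΓ]; exact x.isExposed.subset hpF
  obtain ⟨e, he, hep⟩ := exists_coord hN hpΓ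
  rw [← hep] at hpF
  have heF := mem_face_of_point_mem hN hΓ x.isExposed he hpF
  obtain ⟨τ, hτ, heτ, he1⟩ := exists_support he
  have heτ0 : ∀ u ∉ τ, e u = 0 := fun u hu => by_contra fun h => hu ((heτ u).2 h)
  have hστ : x.simplex.1 ⊆ τ := hθ τ hτ (by
    rw [← hep, point_eq_of_subset (hN τ hτ) heτ0]
    exact mem_convexHull_of_coord he.1 he1)
  have hpe : x.proj N π e = (θ * ε) • z := by
    rw [Xi.proj, hep, add_sub_cancel_left, map_smul, ← hz, smul_smul]
  set t := off x.simplex.1 e with ht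
  have t0 : ∀ u, 0 ≤ t u := off_nonneg he.1
  have tσ : ∀ u ∈ x.simplex.1, t u = 0 := fun u hu => off_of_mem hu
  have tτ : ∀ u ∉ τ, t u = 0 := fun u hu => by
    rw [ht, off_of_notMem fun h => hu (hστ h), heτ0 u hu]
  set H := height x.simplex.1 N t with hH
  have H0 : 0 ≤ H := height_nonneg t0
  -- The factor giving the coordinates off `σ` the height `‖z‖`. If `H = 0` then `z = 0`, and the
  -- default value of the division is the right one.
  set l := ‖z‖ / H with hl
  have l0 : 0 ≤ l := by positivity
  have lH : l * H = ‖z‖ := by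
    by_cases hz0 : z = 0
    · rw [hl, hz0, norm_zero, zero_div, zero_mul]
    · refine div_mul_cancel₀ _ (Xi.height_off_pos hN he fun h => hz0 ?_).ne'
      have := Xi.proj_eq_zero_of_off hπ hN he h
      rw [hpe] at this
      exact (smul_eq_zero.1 this).resolve_left (by positivity)
  set T := ∑ u ∈ N, t u with hT
  have sl : ∑ u ∈ N, (l • t) u = l * T := by rw [hT, Finset.mul_sum]; rfl
  have hle : ∀ u, l * t u ≤ (1 - l * T) / x.simplex.1.card := by
    intro u
    rw [le_div_iff₀ hk]
    have h1 : t u ≤ ‖fun u : N => t u‖ := by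
      by_cases hu : u ∈ N
      · exact (le_abs_self _).trans (norm_le_pi_norm (fun u : N => t u) ⟨u, hu⟩)
      · rw [tτ u fun h => hu (hN τ hτ h)]; positivity
    have h2 : l * H = l * (x.simplex.1.card * ‖fun u : N => t u‖) + l * T := by
      rw [hH, height, mul_add]
    have h3 : l * (x.simplex.1.card * t u) ≤ l * (x.simplex.1.card * ‖fun u : N => t u‖) :=
      mul_le_mul_of_nonneg_left (mul_le_mul_of_nonneg_left h1 hk.le) l0
    calc l * t u * x.simplex.1.card = l * (x.simplex.1.card * t u) := by ring
      _ ≤ l * H - l * T := by rw [h2, add_sub_cancel_right]; exact h3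
      _ ≤ 1 - l * T := by rw [lH]; exact sub_le_sub_right hz1 _
  have hr0 : 0 ≤ (1 - l * T) / x.simplex.1.card := by
    obtain ⟨v, hv⟩ := x.simplex_nonempty
    simpa [tσ v hv] using hle v
  have ltσ : ∀ u ∈ x.simplex.1, (l • t) u = 0 := fun u hu => by simp [tσ u hu]
  -- The mass left over by `l • t` is spread evenly over `σ`; it dominates `l • t` because the
  -- height `‖z‖` is at most `1`.
  have hc : join x.simplex.1 (l • t) (fun _ => (1 - l * T) / x.simplex.1.card) ∈ x.coords := by
    refine ⟨join_mem_coordSet hN hτ hστ (fun u => mul_nonneg l0 (t0 u)) (fun _ _ => hr0)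
      (fun u hu => by simp [tτ u hu]) ?_, fun u hu => ?_, fun v hv u => ?_⟩
    · rw [sl, Finset.sum_const, nsmul_eq_mul, mul_div_cancel₀ _ hk.ne', add_sub_cancel]
    · by_cases huσ : u ∈ x.simplex.1
      · exact x.simplex_subset huσ
      · rw [join_of_notMem huσ] at hu
        refine heF u fun h => hu ?_
        rw [Pi.smul_apply, ht, off_of_notMem huσ, h, smul_zero]
    · rw [join_of_mem ltσ hv]
      by_cases huσ : u ∈ x.simplex.1
      · rw [join_of_mem ltσ huσ]
      · rw [join_of_notMem huσ]; exact hle u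
  refine ⟨_, hc, ?_⟩
  set c := join x.simplex.1 (l • t) (fun _ => (1 - l * T) / x.simplex.1.card)
  have hoff : off x.simplex.1 c = l • t := off_join ltσ
  have hpc : x.proj N π c = (l * (θ * ε)) • z := by
    have h1 := hπ.eq_zero_of_mem _ (x.point_sub_center_sub_mem hN hc.1)
    have h2 := hπ.eq_zero_of_mem _ (x.point_sub_center_sub_mem hN he)
    rw [hoff, sl, map_sub, sub_eq_zero] at h1
    rw [map_sub, sub_eq_zero, ← ht, ← hT] at h2
    have pm : point N (l • t) = l • point N t := by
      simp [point, mul_smul, Finset.smul_sum]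
    rw [mul_smul, ← hpe, Xi.proj, Xi.proj, h1, h2, pm, ← map_smul, smul_sub, mul_smul]
  rw [Xi.rescale, hoff, height_smul l0, lH, hpc]
  by_cases hz0 : z = 0
  · rw [hz0, smul_zero, smul_zero]
  · have hzn := norm_pos_iff.2 hz0
    have hlpos : 0 < l := l0.lt_of_ne fun h => by rw [← h, zero_mul] at lH; exact hzn.ne lH
    rw [norm_smul, Real.norm_of_nonneg (by positivity), smul_smul]
    convert one_smul ℝ z using 2
    field_simp

theorem Xi.mem_openCoords_iff [FiniteDimensional ℝ E] (hπ : x.IsProj π)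
    (hN : ∀ τ ∈ Γ.faces, τ ⊆ N) (hΔ : Convex ℝ Δ) (hc : c ∈ x.coords) :
    c ∈ x.openCoords N ↔
      x.rescale N π c ∈ interior (projCone x.face x.center π ∩ closedBall 0 1) := by
  have hF := x.isExposed.convex hΔ
  obtain ⟨r, hr, h⟩ := Xi.exists_rescale_eq hπ hN hc
  rw [interior_inter, interior_closedBall _ one_ne_zero, mem_inter_iff, mem_ball_zero_iff,
    Xi.norm_rescale hπ hN hΔ hc, Xi.height_off_lt_one_iff hN hc, h]
  constructor
  · rintro ⟨-, h1, h2⟩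
    exact ⟨mem_interior_projCone_of_mem_supportInterior hF x.center_mem hπ.map_eq_top h1 hr, h2⟩
  · rintro ⟨h1, h2⟩
    refine ⟨hc.1, ?_, h2⟩
    refine mem_supportInterior_of_mem_interior_projCone x.center_mem x.center_mem_convexHull
      hπ.mem_of_eq_zero (Xi.point_mem hN hΔ hc) (fun l hl v hv => ?_) h1
    obtain ⟨τ, hτ, hcτ, hs⟩ := exists_support hc.1
    have hp := point_eq_of_subset (hN τ hτ) fun u hu => by_contra fun h => hu ((hcτ u).2 h)
    rw [hp] at hl ⊢
    exact eq_of_sum_smul_eq_max (fun u _ => hc.1.1 u) hs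
      (fun u hu => hl u (hc.2.1 u ((hcτ u).1 hu))) le_rfl v
      ((hcτ v).2 (Xi.coords_pos hc hv).ne') (Xi.coords_pos hc hv).ne'

end BallMap

/-! ### Dimensions and characteristic maps. -/

section CharacteristicMap

open Set Metric Topology
open scoped Pointwise

/-- Closed subsets of a compact set are compact, so their images are closed. -/
theorem continuousOn_invFunOn {α β : Type*} [TopologicalSpace α] [TopologicalSpace β] [T2Space β]
    [Nonempty α] {s : Set α} (hs : IsCompact s) {f : α → β} (hf : ContinuousOn f s)
    (hinj : InjOn f s) : ContinuousOn (Function.invFunOn f s) (f '' s) := by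
  rw [continuousOn_iff_isClosed]
  intro t ht
  refine ⟨f '' (s ∩ t), ((hs.inter_right ht).image_of_continuousOn
    (hf.mono inter_subset_left)).isClosed, ?_⟩
  ext y
  constructor
  · rintro ⟨h, a, ha, rfl⟩
    rw [mem_preimage, hinj.leftInvOn_invFunOn ha] at h
    exact ⟨⟨a, ⟨ha, h⟩, rfl⟩, a, ha, rfl⟩
  · rintro ⟨⟨a, ⟨ha, h⟩, rfl⟩, -⟩
    exact ⟨by rwa [mem_preimage, hinj.leftInvOn_invFunOn ha], a, ha, rfl⟩

variable {E : Type*} [NormedAddCommGroup E] [NormedSpace ℝ E]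
  {Δ : Set E} {Γ : Geometry.SimplicialComplex ℝ E} {N : Finset E} {c : E → ℝ} {d : ℕ}

/-- The dimension of the cell `C(F, σ)`. -/
noncomputable def Xi.dim (x : Xi Δ Γ) : ℕ :=
  Module.finrank ℝ (vectorSpan ℝ x.face) + 1 - x.simplex.1.card

theorem Xi.finrank_vectorSpan_simplex (x : Xi Δ Γ) :
    Module.finrank ℝ (vectorSpan ℝ (x.simplex.1 : Set E)) + 1 = x.simplex.1.card := by
  have hne := x.simplex_nonempty.to_subtype
  have := (Γ.indep x.simplex.2).finrank_vectorSpan_add_one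
  have hr : range ((↑) : x.simplex.1 → E) = (x.simplex.1 : Set E) := Subtype.range_coe
  rwa [hr, Fintype.card_coe] at this

theorem Xi.vectorSpan_le (x : Xi Δ Γ) :
    vectorSpan ℝ (x.simplex.1 : Set E) ≤ vectorSpan ℝ x.face :=
  vectorSpan_mono ℝ x.simplex_subset

/-- Since `σ` lies in `F`, the natural-number subtraction in `Xi.dim` does not truncate. -/
theorem Xi.dim_add [FiniteDimensional ℝ E] (x : Xi Δ Γ) :
    x.dim + x.simplex.1.card = Module.finrank ℝ (vectorSpan ℝ x.face) + 1 := by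
  have h1 := x.finrank_vectorSpan_simplex
  have h2 := Submodule.finrank_mono x.vectorSpan_le
  unfold Xi.dim
  omega

/-- Either the face is strictly smaller and loses dimension, or the simplex has strictly more
vertices. -/
theorem Xi.dim_lt [FiniteDimensional ℝ E] {x y : Xi Δ Γ} (h : x < y) : x.dim < y.dim := by
  have hx := x.dim_add
  have hy := y.dim_add
  obtain ⟨hF, hσ⟩ := Xi.le_iff.1 h.le
  have hV := Submodule.finrank_mono (vectorSpan_mono ℝ hF)
  have hcard := Finset.card_le_card hσ
  by_cases hFe : x.face = y.face
  · have hss : y.simplex.1 ⊂ x.simplex.1 := by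
      refine hσ.ssubset_of_ne fun he => h.not_ge (Xi.le_iff.2 ⟨hFe.ge, he.ge⟩)
    have := Finset.card_lt_card hss
    omega
  · have := IsExposed.finrank_vectorSpan_lt x.isExposed x.1.1.2.1 y.isExposed.subset
      (hF.ssubset_of_ne hFe)
    omega

theorem Xi.exists_charMap [FiniteDimensional ℝ E] (hN : ∀ τ ∈ Γ.faces, τ ⊆ N)
    (hfin : Γ.faces.Finite) (hΓ : Γ.space = Δ) (hΔ : Convex ℝ Δ) (x : Xi Δ Γ) (hd : x.dim = d) :
    ∃ φ : (Fin d → ℝ) → E, ContinuousOn φ (closedBall 0 1) ∧ InjOn φ (closedBall 0 1) ∧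
      φ '' closedBall 0 1 = point N '' x.coords ∧ φ '' ball 0 1 = point N '' x.openCoords N := by
  have hfr : d + Module.finrank ℝ (vectorSpan ℝ (x.simplex.1 : Set E)) =
      Module.finrank ℝ (vectorSpan ℝ x.face) := by
    have h1 := x.finrank_vectorSpan_simplex
    have h2 := x.dim_add
    omega
  obtain ⟨π, hπ₁, hπ₂, hπ₃⟩ := exists_projection x.vectorSpan_le hfr
  have hπ : x.IsProj π := ⟨hπ₁, hπ₂, hπ₃⟩
  have hF := x.isExposed.convex hΔ
  have himg := Xi.image_rescale hπ hN hfin hΓ hΔ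
  have hcont := Xi.continuousOn_rescale hπ hN hΔ
  set B := projCone x.face x.center π ∩ closedBall 0 1 with hB
  -- Closedness comes from `B` being the continuous image of the compact set of coordinates.
  have hBcl : IsClosed B :=
    himg ▸ ((Xi.isCompact_coords hfin x).image_of_continuousOn hcont).isClosed
  have hBconv : Convex ℝ B := (convex_projCone hF).inter (convex_closedBall _ _)
  -- An interior point of the cone is shrunk into the open ball; scaling preserves the interior of
  -- the cone.
  have hBne : (interior B).Nonempty := by
    obtain ⟨z, hz⟩ := interior_projCone_nonempty hF x.center_mem hπ₃
    have hr : 0 < (2 * (1 + ‖z‖))⁻¹ := by positivity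
    refine ⟨(2 * (1 + ‖z‖))⁻¹ • z, ?_⟩
    rw [hB, interior_inter, interior_closedBall _ one_ne_zero]
    refine ⟨?_, ?_⟩
    · have h1 : (2 * (1 + ‖z‖))⁻¹ • z ∈ (2 * (1 + ‖z‖))⁻¹ • interior (projCone x.face x.center π) :=
        smul_mem_smul_set hz
      rw [← interior_smul₀ hr.ne'] at h1
      refine interior_mono ?_ h1
      rintro _ ⟨y, hy, rfl⟩
      exact smul_mem_projCone hy hr
    · rw [mem_ball_zero_iff, norm_smul, Real.norm_of_nonneg hr.le, inv_mul_lt_iff₀ (by positivity)]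
      linarith [norm_nonneg z]
  obtain ⟨h, h1, h2, -⟩ := exists_homeomorph_image_interior_closure_frontier_eq_unitBall hBconv
    hBne (isBounded_closedBall.subset inter_subset_right)
  rw [hBcl.closure_eq] at h2
  set ψ : (E → ℝ) → (Fin d → ℝ) := h ∘ x.rescale N π with hψ
  have hψc : ContinuousOn ψ x.coords := h.continuous.comp_continuousOn hcont
  have hψi : InjOn ψ x.coords := h.injective.comp_injOn (Xi.injOn_rescale hπ hN hΔ)
  have hψC : ψ '' x.coords = closedBall 0 1 := by rw [hψ, image_comp, himg, h2]
  have hsub := x.openCoords_subset hN hΓ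
  have hψO : ψ '' x.openCoords N = ball 0 1 := by
    rw [← h1]
    refine Subset.antisymm ?_ ?_
    · rintro _ ⟨c, hc, rfl⟩
      exact mem_image_of_mem h ((Xi.mem_openCoords_iff hπ hN hΔ (hsub hc)).1 hc)
    · rintro _ ⟨z, hz, rfl⟩
      have hz' := interior_subset hz
      rw [← himg] at hz'
      obtain ⟨c, hc, rfl⟩ := hz'
      exact ⟨c, (Xi.mem_openCoords_iff hπ hN hΔ hc).2 hz, rfl⟩
  have hinv : ∀ s ⊆ x.coords, Function.invFunOn ψ x.coords '' (ψ '' s) = s := fun s hs =>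
    (hψi.leftInvOn_invFunOn.mono hs).image_image
  refine ⟨point N ∘ Function.invFunOn ψ x.coords, ?_, ?_, ?_, ?_⟩
  · rw [← hψC]
    exact continuous_point.comp_continuousOn
      (continuousOn_invFunOn (Xi.isCompact_coords hfin x) hψc hψi)
  · rw [← hψC]
    refine ((point_injOn hN).mono fun c hc => hc.1).comp
      (Function.invFunOn_injOn_image ψ x.coords) (mapsTo_iff_image_subset.2 (hinv _ subset_rfl).subset)
  · rw [← hψC, image_comp, hinv _ subset_rfl]
  · rw [← hψO, image_comp, hinv _ hsub]

end CharacteristicMap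

/-! ### The CW structure and its face poset. -/

section Assembly

open Set Metric Topology

universe u

variable {E : Type u} [NormedAddCommGroup E] [NormedSpace ℝ E] [FiniteDimensional ℝ E]
  {Δ : Set E} {Γ : Geometry.SimplicialComplex ℝ E}

theorem exists_regularCW (hΔ : IsPolytope Δ) (hΓ : IsTriangulation Γ Δ) :
    ∃ _cw : CWComplex Δ, IsRegularCW Δ ∧ ∃ e : Xi Δ Γ ≃o CWFace Δ, ∀ x : Xi Δ Γ,
      (e x).closed = x.C ∧ (e x).dim = x.dim ∧ (e x).boundary = ⋃ y < x, y.C := by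
  classical
  have hconv : Convex ℝ Δ := by obtain ⟨V, rfl⟩ := hΔ; exact convex_convexHull ℝ _
  have hfin := hΓ.finite
  have hsp := hΓ.space_eq
  let N : Finset E := hfin.toFinset.biUnion id
  have hN : ∀ τ ∈ Γ.faces, τ ⊆ N := fun τ hτ =>
    Finset.subset_biUnion_of_mem id (hfin.mem_toFinset.2 hτ)
  have hC : ∀ x : Xi Δ Γ, x.C = point N '' x.coords := fun x =>
    x.C_eq hN (x.isExposed.convex hconv)
  have hinj := point_injOn hN
  have hsub : ∀ x : Xi Δ Γ, x.openCoords N ⊆ x.coords := fun x => x.openCoords_subset hN hsp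
  have hXi := finite_xi hfin hsp hconv
  have hex : ∀ c ∈ coordSet Γ, ∃ x : Xi Δ Γ, c ∈ x.openCoords N := fun c hc =>
    exists_mem_openCoords hN hsp hΔ hc
  have hle : ∀ {x y : Xi Δ Γ} {c : E → ℝ}, c ∈ x.openCoords N → c ∈ y.coords → x ≤ y :=
    fun hx hy => Xi.le_of_mem hN hconv hx hy
  choose φ hφc hφi hφC hφO using fun (n : ℕ) (i : {x : Xi Δ Γ // x.dim = n}) =>
    i.1.exists_charMap hN hfin hsp hconv i.2
  -- By injectivity the sphere maps to the closed cell minus the open cell. A point there lies in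
  -- the open cell of some `y ≤ i.1` with `y ≠ i.1`; conversely a smaller closed cell misses the
  -- open cell of `i.1` by `hle`.
  have hbd : ∀ (n : ℕ) (i : {x : Xi Δ Γ // x.dim = n}),
      φ n i '' sphere 0 1 = ⋃ y < i.1, y.C := by
    intro n i
    rw [← closedBall_sdiff_ball, (hφi n i).image_sdiff_subset ball_subset_closedBall, hφC, hφO]
    refine Subset.antisymm ?_ ?_
    · rintro _ ⟨⟨c, hc, rfl⟩, hcO⟩
      obtain ⟨y, hy⟩ := hex c hc.1
      refine mem_iUnion₂.2 ⟨y, (hle hy hc).lt_of_ne fun h => hcO ⟨c, h ▸ hy, rfl⟩, ?_⟩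
      rw [hC]
      exact ⟨c, hsub y hy, rfl⟩
    · refine iUnion₂_subset fun y hy => ?_
      rw [hC]
      rintro _ ⟨c, hc, rfl⟩
      refine ⟨⟨c, Xi.coords_mono hy.le hc, rfl⟩, ?_⟩
      rintro ⟨c', hc', h⟩
      rw [hinj hc'.1 hc.1 h] at hc'
      exact hy.not_ge (hle hc' hc)
  let map : (n : ℕ) → {x : Xi Δ Γ // x.dim = n} → PartialEquiv (Fin n → ℝ) E := fun n i =>
    InjOn.toPartialEquiv (φ n i) (ball 0 1) ((hφi n i).mono ball_subset_closedBall)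
  let cw : CWComplex Δ := CWComplex.mkFinite Δ (fun n => {x : Xi Δ Γ // x.dim = n}) map
    (by
      obtain ⟨M, hM⟩ := (finite_range fun x : Xi Δ Γ => x.dim).bddAbove
      filter_upwards [Filter.eventually_gt_atTop M] with n hn
      exact ⟨fun i => hn.not_ge (i.2 ▸ hM ⟨i.1, rfl⟩)⟩)
    (fun n => inferInstance)
    (fun n i => rfl)
    (fun n i => hφc n i)
    -- The inverse on the open ball agrees with the inverse on the compact closed ball, whose
    -- continuity is known.
    (fun n i => by
      refine ((continuousOn_invFunOn (isCompact_closedBall _ _) (hφc n i) (hφi n i)).mono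
        (image_mono ball_subset_closedBall)).congr ?_
      rintro _ ⟨z, hz, rfl⟩
      rw [(hφi n i).leftInvOn_invFunOn (ball_subset_closedBall hz)]
      exact ((hφi n i).mono ball_subset_closedBall).leftInvOn_invFunOn hz)
    (by
      rintro ⟨n, i⟩ - ⟨m, j⟩ - hne
      refine disjoint_left.2 fun p hp hp' => hne ?_
      change p ∈ φ n i '' ball 0 1 at hp
      change p ∈ φ m j '' ball 0 1 at hp'
      rw [hφO] at hp hp'
      obtain ⟨c, hc, rfl⟩ := hp
      obtain ⟨c', hc', h⟩ := hp'
      rw [hinj hc'.1 hc.1 h] at hc'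
      have hij : i.1 = j.1 := le_antisymm (hle hc (hsub _ hc')) (hle hc' (hsub _ hc))
      obtain ⟨x, rfl⟩ := i
      obtain ⟨y, rfl⟩ := j
      obtain rfl : x = y := hij
      rfl)
    (fun n i => by
      rw [mapsTo_iff_image_subset]
      change φ n i '' sphere 0 1 ⊆ _
      rw [hbd]
      refine iUnion₂_subset fun y hy => ?_
      refine Subset.trans ?_ (subset_iUnion₂_of_subset y.dim (i.2 ▸ Xi.dim_lt hy)
        (subset_iUnion_of_subset ⟨y, rfl⟩ subset_rfl))
      rw [hC, ← hφC _ ⟨y, rfl⟩]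
      rfl)
    (by
      refine Subset.antisymm ?_ ?_
      · refine iUnion₂_subset fun n i => ?_
        change φ n i '' closedBall 0 1 ⊆ _
        rw [hφC]
        rintro _ ⟨c, hc, rfl⟩
        exact i.1.isExposed.subset (Xi.point_mem hN hconv hc)
      · intro p hp
        obtain ⟨c, hc, rfl⟩ := exists_coord hN (hsp.symm ▸ hp)
        obtain ⟨x, hx⟩ := hex c hc
        refine mem_iUnion₂.2 ⟨x.dim, ⟨x, rfl⟩, ?_⟩
        change point N c ∈ φ _ _ '' closedBall 0 1
        rw [hφC]
        exact ⟨c, hsub x hx, rfl⟩)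
  let toFace : Xi Δ Γ → CWFace Δ := fun x => ⟨x.dim, (⟨x, rfl⟩ : {y : Xi Δ Γ // y.dim = x.dim})⟩
  have hclosed : ∀ x : Xi Δ Γ, (toFace x).closed = x.C := fun x => by
    rw [hC, ← hφC _ ⟨x, rfl⟩]
    rfl
  have hCle : ∀ x y : Xi Δ Γ, x.C ⊆ y.C ↔ x ≤ y := by
    intro x y
    rw [hC, hC]
    refine ⟨fun h => ?_, fun h => image_mono (Xi.coords_mono h)⟩
    -- The open cell is nonempty, being the image of a ball; one of its points in `y.C` yields `x ≤
    -- y`.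
    have : (φ x.dim ⟨x, rfl⟩ '' ball 0 1).Nonempty := (nonempty_ball.2 one_pos).image _
    rw [hφO] at this
    obtain ⟨_, c, hc, rfl⟩ := this
    obtain ⟨c', hc', he⟩ := h ⟨c, hsub x hc, rfl⟩
    rw [hinj hc'.1 hc.1 he] at hc'
    exact hle hc hc'
  refine ⟨cw, fun n i => hφi n i, ⟨⟨toFace,
    fun c => (show {y : Xi Δ Γ // y.dim = c.1} from c.2).1, fun _ => rfl, ?_⟩,
    ?_⟩, fun x => ⟨hclosed x, rfl, hbd x.dim ⟨x, rfl⟩⟩⟩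
  · rintro ⟨n, ⟨x, rfl⟩⟩
    rfl
  · intro x y
    change (toFace x).closed ⊆ (toFace y).closed ↔ _
    rw [hclosed, hclosed, hCle]

end Assembly

end CellPairs

theorem mainTheorem6 (n : ℕ) (Δ : Set (EuclideanSpace ℝ (Fin n)))
    (hΔ : CellPairs.IsPolytope Δ)
    (Γ : Geometry.SimplicialComplex ℝ (EuclideanSpace ℝ (Fin n)))
    (hΓ : CellPairs.IsTriangulation Γ Δ) :
    ∃ _cw : Topology.CWComplex Δ, CellPairs.IsRegularCW Δ ∧
      ∃ e : CellPairs.Xi Δ Γ ≃o CellPairs.CWFace Δ, ∀ x : CellPairs.Xi Δ Γ,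
        (e x).closed = x.C ∧
        ((e x).dim : ℤ) =
          (Module.finrank ℝ (vectorSpan ℝ x.face) : ℤ) - ((x.simplex.1.card : ℤ) - 1) ∧
        (e x).boundary = ⋃ y < x, y.C := by
  obtain ⟨cw, hreg, e, he⟩ := CellPairs.exists_regularCW hΔ hΓ
  refine ⟨cw, hreg, e, fun x => ⟨(he x).1, ?_, (he x).2.2⟩⟩
  have := x.dim_add
  rw [(he x).2.1]
  omega
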